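/- **Setting.** Let $d\ge 1$, $N\ge 0$, and let $\mathcal X\subseteq\mathbb R^d$ be closed and convex. Slots are $t=1,\dots,T$. In slot $t$ there are a loss $f_t:\mathbb R^d\to\mathbb R$ and constraint functions $\mathbf g_t=(g_t^1,\dots,g_t^N):\mathbb R^d\to\mathbb R^N$, fixed in advance. Norms are Euclidean. Assume, for all $t$ and $n$: 1. $f_t$ and $g_t^n$ are convex on $\mathbb R^d$. 2. $|f_t(\mathbf x)|\le F$ for $\mathbf x\in\mathcal X$; and $f_t$, $g_t^n$ are differentiable at every $\mathbf x\in\mathcal X$ with $\|\nabla f_t(\mathbf x)\|\le G$ and $\|\nabla g_t^n(\mathbf x)\|\le G$. 3. There are $\eta>0$ and $\tilde{\mathbf x}\in(1-\gamma)\mathcal X$ with $g_t^n(\tilde{\mathbf x})\le-\eta$ for all $t,n$. 4. $r\mathbb B\subseteq\mathcal X\subseteq R\mathbb B$ for some $0<r\le R$, where $\mathbb B$ is the closed unit ball. **Algorithm (BanSaP with one-point feedback).** Let $\alpha,\mu,\delta>0$, $\gamma<1$, $\hat{\mathbf x}_1\in(1-\gamma)\mathcal X$, $\boldsymbol\lambda_1=\mathbf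 0$, and let $\mathbf u_1,\mathbf u_2,\dots$ be independent and uniformly distributed on the unit sphere of $\mathbb R^d$. In slot $t$ the action is $\mathbf x_{1,t}=\hat{\mathbf x}_t+\delta\mathbf u_t$, and with the orthogonal projection $\mathcal P_{(1-\gamma)\mathcal X}$ on $(1-\gamma)\mathcal X$, $$\hat{\mathbf x}_{t+1}=\mathcal P_{(1-\gamma)\mathcal X}\Big(\hat{\mathbf x}_t-\alpha\Big[\tfrac d\delta f_t(\hat{\mathbf x}_t+\delta\mathbf u_t)\mathbf u_t+\sum_n\lambda_t^n\nabla g_t^n(\hat{\mathbf x}_t)\Big]\Big),$$ $$\lambda_{t+1}^n=\max\Big\{\lambda_t^n+\mu\big(g_t^n(\hat{\mathbf x}_t)+\langle\nabla g_t^n(\hat{\mathbf x}_t),\hat{\mathbf x}_{t+1}-\hat{\mathbf x}_t\rangle\big),\,0\Big\}.$$ **Metrics.** For $1\le t\le T$ let $\mathbf x_t^*$ be a minimizer of $f_t$ over $\{\mathbf x\in\mathcal X:\mathbf g_t(\mathbf x)\le\mathbf 0\}$, and let $\mathbf x_0^*\in\mathcal X$ be any reference point. Put $$\mathrm{Reg}^{\rm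 d}_T=\sum_{t=1}^T\mathbb E[f_t(\mathbf x_{1,t})]-\sum_{t=1}^Tf_t(\mathbf x_t^*),\qquad \mathrm{Fit}^{\rm d}_T=\Big\|\Big[\sum_{t=1}^T\mathbf g_t(\mathbf x_{1,t})\Big]^+\Big\|,$$ $$V(\mathbf x^*_{1:T})=\sum_{t=1}^T\|\mathbf x_t^*-\mathbf x_{t-1}^*\|,\qquad \|\bar{\boldsymbol\lambda}\|=\max_{1\le t\le T+1}\|\boldsymbol\lambda_t\|.$$ $\mathrm{Fit}^{\rm d}_T$ and $\|\bar{\boldsymbol\lambda}\|$ are random variables. **(i) Explicit bounds.** Let $\delta\le\gamma r$. Then $f_t(\mathbf x_{1,t})$, $\|\bar{\boldsymbol\lambda}\|$ and $\mathrm{Fit}^{\rm d}_T$ are integrable. Let $J\ge 0$ satisfy $\sum_n\|\nabla g_t^n(\mathbf x)\|^2\le J^2$ for all $t$ and $\mathbf x\in\mathcal X$ ($J=\sqrt N\,G$ always does). Then $$\mathrm{Reg}^{\rm d}_T\le\frac R\alpha V(\mathbf x^*_{1:T})+\frac{R^2+\|\hat{\mathbf x}_1-\mathbf x_0^*\|^2}{2\alpha}+\frac{d^2F^2\alpha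 T}{\delta^2}+2G\delta T+\gamma RT\big(G+J\,\mathbb E\|\bar{\boldsymbol\lambda}\|\big)+2\mu J^2R^2T,$$ and, for every $\beta>0$ and every realization of the directions, $$\mathrm{Fit}^{\rm d}_T\le\frac{\|\bar{\boldsymbol\lambda}\|}\mu+\frac{G^2\sqrt N\,T}{2\beta}+\delta G\sqrt N\,T+\beta\sqrt N\,T\Big(\frac{\alpha^2d^2F^2}{\delta^2}+\alpha^2J^2\|\bar{\boldsymbol\lambda}\|^2\Big).$$ **(ii) Rates.** For all $a_1,b_1>0$ and $a_2,b_2$ there is a constant $C$, depending only on $a_1,a_2,b_1,b_2$ and $d,N,F,G,r,R,\eta$, such that for all $T\ge1$ and all problems as above, if $\alpha=\mu$, $a_1T^{-3/4}\le\alpha\le a_2T^{-3/4}$, $b_1T^{-1/4}\le\delta\le b_2T^{-1/4}$ and $\gamma=\delta/r<1$, then all actions are feasible, $\mathbf x_{1,t}\in\mathcal X$, and $$\mathrm{Reg}^{\rm d}_T\le C\,\big(1+V(\mathbf x_{1:T}^*)\big)T^{3/4},\qquad \mathbb E[\mathrm{Fit}^{\rm d}_T]\le C\,T^{3/4},\qquad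 \mathbb P\big(\mathrm{Fit}^{\rm d}_T>C\,T^{3/4}\big)\le C\,T^{-2}.$$ -/

import Mathlib

open MeasureTheory ProbabilityTheory Set Metric
open scoped Pointwise

noncomputable section

namespace BanSaP

/-- The action space `ℝ^d` with its Euclidean norm. -/
abbrev Vec (d : ℕ) : Type := EuclideanSpace ℝ (Fin d)

/-- The uniform probability distribution on the unit sphere of `ℝ^d`:
the normalized surface measure. -/
def sphereUniform (d : ℕ) : Measure (sphere (0 : Vec d) 1) :=
  ((volume : Measure (Vec d)).toSphere univ)⁻¹ • (volume : Measure (Vec d)).toSphere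

/-- The Euclidean projection of `y` on `K`: a point of `K` nearest to `y`
(it exists and is unique when `K` is nonempty, closed and convex). -/
def proj {d : ℕ} (K : Set (Vec d)) (y : Vec d) : Vec d :=
  Classical.epsilon fun p => p ∈ K ∧ ∀ z ∈ K, ‖p - y‖ ≤ ‖z - y‖

/-- The data of a constrained online problem: action set `X`, losses `f t` and
vector-valued constraint functions `g t`, in slots `t = 1, 2, …`. -/
structure Problem (d N : ℕ) where
  X : Set (Vec d)
  f : ℕ → Vec d → ℝ
  g : ℕ → Vec d → EuclideanSpace ℝ (Fin N)

/-- The parameters of the method: primal stepsize `α`, dual stepsize `μ`, perturbation size `δ`,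
shrinkage `γ`, and the initial primal iterate `x₁`. -/
structure Params (d : ℕ) where
  α : ℝ
  μ : ℝ
  δ : ℝ
  γ : ℝ
  x₁ : Vec d

variable {d N : ℕ}

/-- The gradient of the `n`-th constraint of slot `t`. -/
def Problem.gradG (I : Problem d N) (t : ℕ) (n : Fin N) (x : Vec d) : Vec d :=
  gradient (fun y => I.g t y n) x

/-- The one-point gradient estimator `(d/δ) f (x + δ u) u`. -/
def onePoint (δ : ℝ) (f : Vec d → ℝ) (x u : Vec d) : Vec d :=
  ((d : ℝ) / δ * f (x + δ • u)) • u

/-- The one-point estimate of the gradient in `x` of the online Lagrangian of slot `t`. -/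
def lagrangianGrad (I : Problem d N) (p : Params d) (t : ℕ) (x : Vec d)
    (lam : EuclideanSpace ℝ (Fin N)) (u : Vec d) : Vec d :=
  onePoint p.δ (I.f t) x u + ∑ n, lam n • I.gradG t n x

/-- The primal update of slot `t`, projected on `(1 - γ) X`. -/
def primalStep (I : Problem d N) (p : Params d) (t : ℕ) (x : Vec d)
    (lam : EuclideanSpace ℝ (Fin N)) (u : Vec d) : Vec d :=
  proj ((1 - p.γ) • I.X) (x - p.α • lagrangianGrad I p t x lam u)

/-- The dual update of slot `t`, from the primal iterates `x` and `x'` of slots `t` and `t + 1`. -/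
def dualStep (I : Problem d N) (p : Params d) (t : ℕ) (x x' : Vec d)
    (lam : EuclideanSpace ℝ (Fin N)) : EuclideanSpace ℝ (Fin N) :=
  WithLp.toLp 2 fun n =>
    max (lam n + p.μ * (I.g t x n + inner ℝ (I.gradG t n x) (x' - x))) 0

/-- The pair of the primal and the dual iterate in slot `t`, for a sequence `u` of directions.
Slots start at `1`, with primal iterate `x₁` and dual iterate `0`; the value at `0` is a dummy. -/
def state (I : Problem d N) (p : Params d) (u : ℕ → Vec d) :
    ℕ → Vec d × EuclideanSpace ℝ (Fin N)
  | 0 => (p.x₁, 0)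
  | 1 => (p.x₁, 0)
  | t + 2 =>
    let s := state I p u (t + 1)
    let x' := primalStep I p (t + 1) s.1 s.2 (u (t + 1))
    (x', dualStep I p (t + 1) s.1 x' s.2)

/-- The primal (learning) iterate of slot `t`. -/
def xhat (I : Problem d N) (p : Params d) (u : ℕ → Vec d) (t : ℕ) : Vec d :=
  (state I p u t).1

/-- The dual iterate of slot `t`. -/
def dual (I : Problem d N) (p : Params d) (u : ℕ → Vec d) (t : ℕ) : EuclideanSpace ℝ (Fin N) :=
  (state I p u t).2

/-- The action played in slot `t`. -/
def action (I : Problem d N) (p : Params d) (u : ℕ → Vec d) (t : ℕ) : Vec d :=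
  xhat I p u t + p.δ • u t

/-- The largest norm of a dual iterate up to slot `T + 1`. -/
def dualMax (I : Problem d N) (p : Params d) (u : ℕ → Vec d) (T : ℕ) : ℝ :=
  (Finset.Icc 1 (T + 1)).sup' ⟨1, by simp⟩ fun t => ‖dual I p u t‖

/-- The dynamic fit: the norm of the positive part of the accumulated constraint values. -/
def dynFit (I : Problem d N) (p : Params d) (u : ℕ → Vec d) (T : ℕ) : ℝ :=
  ‖(WithLp.toLp 2 fun n => max (∑ t ∈ Finset.Icc 1 T, I.g t (action I p u t) n) 0 :
    EuclideanSpace ℝ (Fin N))‖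

/-- A sequence of directions realized on a sample space, read as vectors of `ℝ^d`. -/
def directions {Ω : Type*} (u : ℕ → Ω → sphere (0 : Vec d) 1) (ω : Ω) : ℕ → Vec d :=
  fun t => (u t ω : Vec d)

/-- The directions are independent and uniformly distributed on the unit sphere. -/
structure UniformDirections {Ω : Type*} [MeasurableSpace Ω] (P : Measure Ω)
    (u : ℕ → Ω → sphere (0 : Vec d) 1) : Prop where
  measurable : ∀ t, Measurable (u t)
  indep : iIndepFun u P
  law : ∀ t, P.map (u t) = sphereUniform d

/-- The dynamic regret of the random actions with respect to the comparators `xs 1, …, xs T`. -/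
def dynRegret {Ω : Type*} [MeasurableSpace Ω] (P : Measure Ω) (I : Problem d N) (p : Params d)
    (u : ℕ → Ω → sphere (0 : Vec d) 1) (xs : ℕ → Vec d) (T : ℕ) : ℝ :=
  ∑ t ∈ Finset.Icc 1 T, ∫ ω, I.f t (action I p (directions u ω) t) ∂P
    - ∑ t ∈ Finset.Icc 1 T, I.f t (xs t)

/-- `x` minimizes the loss of slot `t` over the actions that satisfy the constraint of slot `t`. -/
def IsSlotMinimizer (I : Problem d N) (t : ℕ) (x : Vec d) : Prop :=
  (x ∈ I.X ∧ ∀ n, I.g t x n ≤ 0) ∧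
    ∀ y ∈ I.X, (∀ n, I.g t y n ≤ 0) → I.f t x ≤ I.f t y

/-- The per-slot minimizers `xs 1, …, xs T`, preceded by a reference point `xs 0` of `X`. -/
def IsMinimizerPath (I : Problem d N) (T : ℕ) (xs : ℕ → Vec d) : Prop :=
  xs 0 ∈ I.X ∧ ∀ t ∈ Finset.Icc 1 T, IsSlotMinimizer I t (xs t)

/-- The accumulated variation `∑_{t=1}^T ‖xs t - xs (t - 1)‖`. -/
def variation (xs : ℕ → Vec d) (T : ℕ) : ℝ :=
  ∑ t ∈ Finset.range T, ‖xs (t + 1) - xs t‖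

/-- The standing assumptions up to the horizon `T`: convexity, bounded losses, bounded gradients,
a Slater point in `(1 - γ) X`, and an action set between two balls. -/
structure Assumptions (I : Problem d N) (T : ℕ) (F G r R η γ : ℝ) : Prop where
  convex_X : Convex ℝ I.X
  closed_X : IsClosed I.X
  convex_f : ∀ t ∈ Finset.Icc 1 T, ConvexOn ℝ univ (I.f t)
  convex_g : ∀ t ∈ Finset.Icc 1 T, ∀ n, ConvexOn ℝ univ fun x => I.g t x n
  bound_f : ∀ t ∈ Finset.Icc 1 T, ∀ x ∈ I.X, |I.f t x| ≤ F
  diff_f : ∀ t ∈ Finset.Icc 1 T, ∀ x ∈ I.X, DifferentiableAt ℝ (I.f t) x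
  grad_f : ∀ t ∈ Finset.Icc 1 T, ∀ x ∈ I.X, ‖gradient (I.f t) x‖ ≤ G
  diff_g : ∀ t ∈ Finset.Icc 1 T, ∀ n, ∀ x ∈ I.X, DifferentiableAt ℝ (fun y => I.g t y n) x
  grad_g : ∀ t ∈ Finset.Icc 1 T, ∀ n, ∀ x ∈ I.X, ‖I.gradG t n x‖ ≤ G
  eta_pos : 0 < η
  slater : ∃ x ∈ (1 - γ) • I.X, ∀ t ∈ Finset.Icc 1 T, ∀ n, I.g t x n ≤ -η
  r_pos : 0 < r
  r_le : r ≤ R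
  ball_subset : closedBall 0 r ⊆ I.X
  subset_ball : I.X ⊆ closedBall 0 R

/-- Admissible parameters: positive stepsizes and perturbation, `γ < 1`, a perturbation that the
shrinkage leaves room for, and an initial iterate in the shrunken set. -/
structure Admissible (I : Problem d N) (p : Params d) (r : ℝ) : Prop where
  alpha_pos : 0 < p.α
  mu_pos : 0 < p.μ
  delta_pos : 0 < p.δ
  gamma_lt : p.γ < 1
  delta_le : p.δ ≤ p.γ * r
  init_mem : p.x₁ ∈ (1 - p.γ) • I.X

end BanSaP

end

/-! Two per-slot inequalities drive everything. The projection step, tested at a comparator y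
(`primal_step_le`), bounds the linearized loss plus the coupling term Σ λⁿ⟨∇gⁿ(x̂), x̂' - y⟩, where
x̂' is the next iterate, by a telescoping difference and α(dF/δ)²/2. The dual step (`dual_step_le`)
bounds the growth of ‖λ‖² by the same coupling term plus the constraint values at y. Adding them
cancels the coupling. The choice y = (1-γ)x*ₜ gives the regret, with moving comparators handled by
Abel summation (`sum_norm_sq_sub_eq`). The fit follows because λ' - λ dominates μ times the
linearized constraint, so the sum of constraints telescopes to λ/μ up to the movement of the
iterates.

In expectation the linearized loss must dominate f(x̂) - f(y). `le_integral_inner_onePoint` proves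
this for convex f without differentiating a smoothed loss: u is grouped with its images under
reflection in the axis x - y and under negation, and one-dimensional convexity is applied to each
group of four points. Independence of the direction from the current iterates and Fubini
(`integral_state_eq`) carry this to the algorithm.

The rates need the maximal dual norm to be O(1), although the feedback has size of order 1/δ, that
is T^(1/4). For a Slater point s, Φ = ‖λ‖² + ‖x̂ - s‖² has drift at most 2α(O(1) - η‖λ‖) plus noise.
The noise has range O(1/δ), but its conditional mean is bounded above by 2α(2F + Gδ). Hoeffding's
lemma therefore controls exp(θΦ) for θ of order T^(1/4) (`integral_exp_lyapunov_succ_le`). Markov's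
inequality and a union bound give a tail (T+1)²exp(-θ), which is O(T⁻²). On the exceptional event
the deterministic growth bound `dualMax_le` suffices for the mean. -/

noncomputable section

namespace BanSaP

/-! ### The one-point estimator as an approximate subgradient. -/

section

variable {d N : ℕ}

/-- A chord of a convex function, compared with translates of its centre. -/
theorem chord_of_convexOn {k : ℝ → ℝ} (hk : ConvexOn ℝ univ k) {s Z p Q : ℝ} (hZ : 0 < Z)
    (h0 : p ≤ k 0) (hQ : ∀ τ, |τ| ≤ |s| → k (τ - Z) ≤ Q) :
    2 * s ^ 2 * (p - Q) ≤ Z * (s * (k s - k (-s))) := by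
  have key : ∀ s : ℝ, 0 < s → (∀ τ, |τ| ≤ s → k (τ - Z) ≤ Q) →
      2 * s * (p - Q) ≤ Z * (k s - k (-s)) := by
    intro s hs hQ
    have hmid : k 0 ≤ (k s + k (-s)) / 2 := by
      have h := hk.2 (mem_univ s) (mem_univ (-s))
        (by norm_num : (0 : ℝ) ≤ 1 / 2) (by norm_num : (0 : ℝ) ≤ 1 / 2) (by norm_num)
      simp only [smul_eq_mul] at h
      rw [show 1 / 2 * s + 1 / 2 * -s = 0 by ring] at h
      linarith
    -- If s ≤ Z, then -s lies in [-Z, 0] and convexity bounds k (-s). If s ≥ Z, then -s and 0 are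
    -- both of the form τ - Z with |τ| ≤ s, so p ≤ Q and the midpoint inequality suffices.
    rcases le_total s Z with hsZ | hsZ
    · have h := hk.2 (mem_univ (-Z)) (mem_univ (0 : ℝ))
        (by positivity : 0 ≤ s / Z) (by rwa [sub_nonneg, div_le_one hZ] : 0 ≤ 1 - s / Z) (by ring)
      simp only [smul_eq_mul] at h
      rw [show s / Z * -Z + (1 - s / Z) * 0 = -s by field_simp; ring] at h
      have h1 : Z * k (-s) ≤ s * k (-Z) + (Z - s) * k 0 := by
        calc Z * k (-s) ≤ Z * (s / Z * k (-Z) + (1 - s / Z) * k 0) := by gcongr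
          _ = s * k (-Z) + (Z - s) * k 0 := by field_simp
      have h2 : k (-Z) ≤ Q := by simpa using hQ 0 (by simpa using hs.le)
      nlinarith
    · have h1 : k (-s) ≤ Q := by
        simpa using hQ (Z - s) (by rw [abs_le]; constructor <;> linarith)
      have h2 : k 0 ≤ Q := by simpa using hQ Z (by rw [abs_le]; constructor <;> linarith)
      rcases le_total 0 (k s - k (-s)) with h3 | h3
      · nlinarith [mul_nonneg hZ.le h3]
      · nlinarith
  rcases lt_trichotomy s 0 with hs | hs | hs
  · have h := key (-s) (by linarith) (by rwa [abs_of_neg hs] at hQ)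
    rw [neg_neg] at h
    nlinarith
  · simp [hs]
  · have h := key s hs (by rwa [abs_of_pos hs] at hQ)
    nlinarith

/-- The homeomorphism of the unit sphere induced by a linear isometry. -/
def sphereIso (L : Vec d ≃ₗᵢ[ℝ] Vec d) : sphere (0 : Vec d) 1 ≃ₜ sphere (0 : Vec d) 1 where
  toFun u := ⟨L u, by simp⟩
  invFun u := ⟨L.symm u, by simp⟩
  left_inv u := by simp
  right_inv u := by simp
  continuous_toFun := by fun_prop
  continuous_invFun := by fun_prop

/-- The spherical measure of a set is, up to a factor, the volume of the cone of its multiples by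
scalars in (0, 1). Linear isometries preserve volume and commute with forming this cone. -/
theorem measurePreserving_sphereIso (L : Vec d ≃ₗᵢ[ℝ] Vec d) :
    MeasurePreserving (sphereIso L) (sphereUniform d) (sphereUniform d) := by
  refine ⟨(sphereIso L).continuous.measurable, ?_⟩
  rw [sphereUniform, Measure.map_smul]
  congr 1
  ext s hs
  rw [Measure.map_apply (sphereIso L).continuous.measurable hs, Measure.toSphere_apply' _ hs,
    Measure.toSphere_apply' _ ((sphereIso L).continuous.measurable hs)]
  congr 1
  have : Ioo (0 : ℝ) 1 • (Subtype.val '' (sphereIso L ⁻¹' s) : Set (Vec d)) =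
      L.toMeasurableEquiv ⁻¹' (Ioo (0 : ℝ) 1 • (Subtype.val '' s : Set (Vec d))) := by
    ext v
    simp only [Set.mem_smul, mem_image, mem_preimage]
    constructor
    · rintro ⟨a, ha, _, ⟨u, hu, rfl⟩, rfl⟩
      exact ⟨a, ha, _, ⟨_, hu, rfl⟩, by simp [sphereIso]⟩
    · rintro ⟨a, ha, _, ⟨u, hu, rfl⟩, hv⟩
      refine ⟨a, ha, _, ⟨(sphereIso L).symm u, by simpa using hu, rfl⟩, ?_⟩
      have hv' : a • (u : Vec d) = L v := hv
      change a • L.symm (u : Vec d) = v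
      rw [← map_smul, hv', L.symm_apply_apply]
  rw [this]
  exact L.measurePreserving.measure_preimage_equiv (f := L.toMeasurableEquiv) _

theorem integral_sphere_isometry (L : Vec d ≃ₗᵢ[ℝ] Vec d) (φ : Vec d → ℝ) :
    ∫ u : sphere (0 : Vec d) 1, φ (L u) ∂sphereUniform d = ∫ u, φ u ∂sphereUniform d :=
  (measurePreserving_sphereIso L).integral_comp (sphereIso L).measurableEmbedding
    (fun u => φ (u : Vec d))

theorem isProbabilityMeasure_sphereUniform (hd : 1 ≤ d) :
    IsProbabilityMeasure (sphereUniform d) := by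
  have : Nonempty (Fin d) := ⟨⟨0, hd⟩⟩
  refine ⟨?_⟩
  rw [sphereUniform, Measure.smul_apply, smul_eq_mul]
  refine ENNReal.inv_mul_cancel ?_ (measure_ne_top _ _)
  rw [Ne, Measure.measure_univ_eq_zero]
  exact Measure.toSphere_ne_zero _

theorem integrable_sphere (hd : 1 ≤ d) {φ : Vec d → ℝ} (hφ : Continuous φ) :
    Integrable (fun u : sphere (0 : Vec d) 1 => φ u) (sphereUniform d) := by
  have := isProbabilityMeasure_sphereUniform hd
  exact (hφ.comp continuous_subtype_val).integrable_of_hasCompactSupport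
    (HasCompactSupport.of_compactSpace _)

/-- A reflection carries any unit vector to any other, so the second moment is the same in all
directions; over an orthonormal basis the d moments add up to 1. -/
theorem integral_inner_sq_sphere (hd : 1 ≤ d) {e : Vec d} (he : ‖e‖ = 1) :
    ∫ u : sphere (0 : Vec d) 1, inner ℝ (u : Vec d) e ^ 2 ∂sphereUniform d = 1 / d := by
  have := isProbabilityMeasure_sphereUniform hd
  have h1 : ∀ e' : Vec d, ‖e'‖ = 1 →
      ∫ u : sphere (0 : Vec d) 1, inner ℝ (u : Vec d) e' ^ 2 ∂sphereUniform d =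
      ∫ u : sphere (0 : Vec d) 1, inner ℝ (u : Vec d) e ^ 2 ∂sphereUniform d := by
    intro e' he'
    let L := (Submodule.span ℝ {e - e'})ᗮ.reflection
    have hL : L e = e' := Submodule.reflection_sub (by rw [he, he'])
    rw [← integral_sphere_isometry L fun u => inner ℝ u e' ^ 2]
    congr! 3 with u
    rw [← hL, L.inner_map_map]
  have h2 : ∑ i : Fin d, ∫ u : sphere (0 : Vec d) 1,
      inner ℝ (u : Vec d) (EuclideanSpace.single i (1 : ℝ)) ^ 2 ∂sphereUniform d = 1 := by
    rw [← integral_finsetSum _ fun i _ => integrable_sphere hd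
      (φ := fun u => inner ℝ u (EuclideanSpace.single i (1 : ℝ)) ^ 2) (by fun_prop)]
    have : ∀ u : sphere (0 : Vec d) 1,
        ∑ i : Fin d, inner ℝ (u : Vec d) (EuclideanSpace.single i (1 : ℝ)) ^ 2 = 1 := by
      intro u
      have hu : ‖(u : Vec d)‖ = 1 := by simp
      have := EuclideanSpace.real_norm_sq_eq (u : Vec d)
      rw [hu] at this
      simp [EuclideanSpace.inner_single_right, ← this]
    simp [this]
  rw [Finset.sum_congr rfl fun i _ => h1 _ (by simp)] at h2
  simp only [Finset.sum_const, Finset.card_univ, Fintype.card_fin, nsmul_eq_mul] at h2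
  have : (d : ℝ) ≠ 0 := by positivity
  field_simp
  linarith

/-- The one-point estimator is, in expectation, an approximate subgradient. -/
theorem le_integral_inner_onePoint (hd : 1 ≤ d) {f : Vec d → ℝ} (hf : ConvexOn ℝ univ f)
    {x y : Vec d} {δ c : ℝ} (hδ : 0 < δ) (hc : 0 ≤ c)
    (hy : ∀ v : Vec d, ‖v‖ ≤ 1 → f (y + δ • v) ≤ f y + c) :
    f x - f y - c ≤
      ∫ u : sphere (0 : Vec d) 1, inner ℝ (onePoint δ f x u) (x - y) ∂sphereUniform d := by
  have := isProbabilityMeasure_sphereUniform hd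
  have hfc : Continuous f := hf.locallyLipschitz.continuous
  have hd0 : (0 : ℝ) < d := by positivity
  rcases eq_or_ne x y with rfl | hxy
  · simp [hc]
  set z := x - y with hz
  have hz0 : 0 < ‖z‖ := by rw [norm_pos_iff]; exact sub_ne_zero.2 hxy
  set e : Vec d := ‖z‖⁻¹ • z with he
  have he1 : ‖e‖ = 1 := by
    rw [he, norm_smul, norm_inv, norm_norm, inv_mul_cancel₀ hz0.ne']
  have hze : z = ‖z‖ • e := by rw [he, smul_smul, mul_inv_cancel₀ hz0.ne', one_smul]
  -- Z is the distance from x to y in units of δ: lowering the e-coordinate of u by Z turns x + δu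
  -- into y + δu.
  set Z := ‖z‖ / δ with hZ
  have hZ0 : 0 < Z := by positivity
  have hδZ : δ • Z • e = z := by
    rw [smul_smul, hZ, mul_div_cancel₀ _ hδ.ne', ← hze]
  let h : Vec d → ℝ := fun v => f (x + δ • v)
  have hh : Continuous h := by fun_prop
  -- ρ fixes the component of u along e and negates the orthogonal one.
  let ρ := (Submodule.span ℝ {e}).reflection
  have hρ : ∀ u, ρ u = (2 * inner ℝ u e) • e - u := by
    intro u
    have := Submodule.reflection_singleton_apply (𝕜 := ℝ) e u
    simp only [he1] at this
    rw [show ρ u = _ from this, real_inner_comm]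
    simp [two_smul, two_mul, add_smul]
  have hρe : ρ e = e := by rw [hρ, real_inner_self_eq_norm_sq, he1]; module
  have hρi : ∀ u, inner ℝ (ρ u) e = inner ℝ u e := by
    intro u
    rw [← ρ.inner_map_map u e, hρe]
  let A := ∫ u : sphere (0 : Vec d) 1, inner ℝ (u : Vec d) e * h u ∂sphereUniform d
  have hA : ∫ u : sphere (0 : Vec d) 1, inner ℝ (onePoint δ f x u) z ∂sphereUniform d
      = d * Z * A := by
    rw [← integral_const_mul]
    congr! 2 with u
    rw [onePoint, hze, inner_smul_left, inner_smul_right]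
    simp only [h, hZ, RCLike.conj_to_real]
    field_simp
  have hA2 : ∫ u : sphere (0 : Vec d) 1, inner ℝ (u : Vec d) e * h (ρ u) ∂sphereUniform d = A := by
    simpa only [hρi] using integral_sphere_isometry ρ fun u => inner ℝ u e * h u
  have hA3 : ∫ u : sphere (0 : Vec d) 1, inner ℝ (u : Vec d) e * h (-u) ∂sphereUniform d = -A := by
    rw [← integral_sphere_isometry (LinearIsometryEquiv.neg ℝ) fun u => inner ℝ u e * h (-u)]
    simp [integral_neg, A]
  have hA4 : ∫ u : sphere (0 : Vec d) 1, inner ℝ (u : Vec d) e * h (-(ρ u)) ∂sphereUniform d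
      = -A := by
    rw [← hA3, ← integral_sphere_isometry ρ fun u => inner ℝ u e * h (-u)]
    simp only [hρi]
  -- The points u, ρu, -ρu, -u have e-coordinates s, s, -s, -s and orthogonal parts w, -w, w, -w.
  -- Averaging f over ±w gives a convex function k of the e-coordinate with f x ≤ k 0, even though w
  -- ≠ 0; the chord inequality then applies to k.
  have hpt : ∀ u : sphere (0 : Vec d) 1,
      4 * (f x - f y - c) * inner ℝ (u : Vec d) e ^ 2 ≤
      Z * (inner ℝ (u : Vec d) e * h u + inner ℝ (u : Vec d) e * h (ρ u)
        - inner ℝ (u : Vec d) e * h (-u) - inner ℝ (u : Vec d) e * h (-(ρ u))) := by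
    rintro ⟨u, hu⟩
    have hu1 : ‖u‖ = 1 := by simpa using hu
    simp only
    set s := inner ℝ u e with hs
    set w := u - s • e with hw
    have hwe : inner ℝ e w = 0 := by
      rw [hw, inner_sub_right, inner_smul_right, real_inner_self_eq_norm_sq, he1,
        real_inner_comm, ← hs]; ring
    have huw : ‖w‖ ^ 2 = 1 - s ^ 2 := by
      rw [hw, norm_sub_sq_real, inner_smul_right, ← hs, norm_smul, he1, hu1, mul_one,
        Real.norm_eq_abs, sq_abs]; ring
    have e1 : s • e + w = u := by rw [hw]; module
    have e2 : s • e - w = ρ u := by rw [hρ, hw]; module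
    have e3 : (-s) • e + w = -ρ u := by rw [hρ, hw]; module
    have e4 : (-s) • e - w = -u := by rw [hw]; module
    clear_value w s
    let k : ℝ → ℝ := fun τ => f (x + δ • (τ • e + w)) / 2 + f (x + δ • (τ • e - w)) / 2
    have hk : ConvexOn ℝ univ k := by
      refine ⟨convex_univ, fun τ₁ _ τ₂ _ a b ha hb hab => ?_⟩
      have h1 := hf.2 (mem_univ (x + δ • (τ₁ • e + w))) (mem_univ (x + δ • (τ₂ • e + w))) ha hb hab
      have h2 := hf.2 (mem_univ (x + δ • (τ₁ • e - w))) (mem_univ (x + δ • (τ₂ • e - w))) ha hb hab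
      have hb' : b = 1 - a := by linarith
      subst hb'
      rw [show a • (x + δ • (τ₁ • e + w)) + (1 - a) • (x + δ • (τ₂ • e + w)) =
        x + δ • ((a * τ₁ + (1 - a) * τ₂) • e + w) by module] at h1
      rw [show a • (x + δ • (τ₁ • e - w)) + (1 - a) • (x + δ • (τ₂ • e - w)) =
        x + δ • ((a * τ₁ + (1 - a) * τ₂) • e - w) by module] at h2
      simp only [smul_eq_mul, k] at h1 h2 ⊢
      linarith
    have hk0 : f x ≤ k 0 := by
      have := hf.2 (mem_univ (x + δ • ((0 : ℝ) • e + w))) (mem_univ (x + δ • ((0 : ℝ) • e - w)))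
        (by norm_num : (0 : ℝ) ≤ 1 / 2) (by norm_num : (0 : ℝ) ≤ 1 / 2) (by norm_num)
      rw [show (1 / 2 : ℝ) • (x + δ • ((0 : ℝ) • e + w)) +
        (1 / 2 : ℝ) • (x + δ • ((0 : ℝ) • e - w)) = x by module] at this
      simp only [smul_eq_mul, k] at this ⊢
      linarith
    have hnorm : ∀ τ, |τ| ≤ |s| → ‖τ • e + w‖ ≤ 1 ∧ ‖τ • e - w‖ ≤ 1 := by
      intro τ hτ
      have hτ2 : τ ^ 2 ≤ s ^ 2 := sq_le_sq.2 hτ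
      rw [← sq_le_one_iff₀ (norm_nonneg _), ← sq_le_one_iff₀ (norm_nonneg _),
        norm_add_sq_real, norm_sub_sq_real, inner_smul_left, hwe, norm_smul, he1, huw, mul_one,
        Real.norm_eq_abs, sq_abs]
      constructor <;> simp only [mul_zero] <;> linarith
    have hxz : x = y + z := by rw [hz]; abel
    have hkQ : ∀ τ, |τ| ≤ |s| → k (τ - Z) ≤ f y + c := by
      intro τ hτ
      have h1 := hy _ (hnorm τ hτ).1
      have h2 := hy _ (hnorm τ hτ).2
      have q1 : x + δ • ((τ - Z) • e + w) = y + δ • (τ • e + w) := by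
        rw [hxz, ← hδZ]; module
      have q2 : x + δ • ((τ - Z) • e - w) = y + δ • (τ • e - w) := by
        rw [hxz, ← hδZ]; module
      simp only [k, q1, q2]
      linarith
    have hmain := chord_of_convexOn hk hZ0 hk0 hkQ
    simp only [k, e1, e2, e3, e4] at hmain
    simp only [h]
    linarith
  have hi : ∀ φ : Vec d → ℝ, Continuous φ → Integrable
      (fun u : sphere (0 : Vec d) 1 => inner ℝ (u : Vec d) e * φ u) (sphereUniform d) :=
    fun φ hφ => integrable_sphere hd (φ := fun u => inner ℝ u e * φ u) (by fun_prop)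
  -- Integration gives 4(f x - f y - c)/d ≤ 4ZA, while the expected linearization is d·Z·A: the
  -- factor d of the estimator exactly offsets the second moment 1/d.
  have hint := integral_mono (μ := sphereUniform d)
    ((integrable_sphere hd (φ := fun u => inner ℝ u e ^ 2) (by fun_prop)).const_mul _)
    (((((hi h hh).add (hi (fun u => h (ρ u)) (by fun_prop))).sub
      (hi (fun u => h (-u)) (by fun_prop))).sub
      (hi (fun u => h (-(ρ u))) (by fun_prop))).const_mul Z) hpt
  rw [integral_const_mul, integral_inner_sq_sphere hd he1, integral_const_mul] at hint
  simp only [Pi.add_apply, Pi.sub_apply] at hint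
  rw [integral_sub, integral_sub, integral_add, hA2, hA3, hA4] at hint
  · rw [hA]
    have : d * (4 * (f x - f y - c) * (1 / d)) ≤ d * (Z * (A + A - -A - -A)) := by gcongr
    field_simp at this
    linarith
  · exact hi h hh
  · exact hi (fun u => h (ρ u)) (by fun_prop)
  · exact (hi h hh).add (hi (fun u => h (ρ u)) (by fun_prop))
  · exact hi (fun u => h (-u)) (by fun_prop)
  · exact ((hi h hh).add (hi (fun u => h (ρ u)) (by fun_prop))).sub
      (hi (fun u => h (-u)) (by fun_prop))
  · exact hi (fun u => h (-(ρ u))) (by fun_prop)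

end

/-! ### Projections, first-order convexity, and the iterates. -/

section

variable {d N : ℕ}

theorem proj_spec {K : Set (Vec d)} (hK : IsClosed K) (hne : K.Nonempty) (y : Vec d) :
    proj K y ∈ K ∧ ∀ z ∈ K, ‖proj K y - y‖ ≤ ‖z - y‖ := by
  obtain ⟨p, hp, h⟩ := hK.exists_infDist_eq_dist hne y
  refine Classical.epsilon_spec (p := fun p => p ∈ K ∧ ∀ z ∈ K, ‖p - y‖ ≤ ‖z - y‖)
    ⟨p, hp, fun z hz => ?_⟩
  rw [← dist_eq_norm, ← dist_eq_norm, dist_comm, ← h, dist_comm]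
  exact infDist_le_dist_of_mem hz

theorem inner_sub_proj_le_zero {K : Set (Vec d)} (hK : IsClosed K) (hne : K.Nonempty)
    (hc : Convex ℝ K) (y : Vec d) {z : Vec d} (hz : z ∈ K) :
    inner ℝ (y - proj K y) (z - proj K y) ≤ 0 := by
  obtain ⟨hp, hmin⟩ := proj_spec hK hne y
  have : Nonempty K := hne.to_subtype
  refine (norm_eq_iInf_iff_real_inner_le_zero hc hp).1 (le_antisymm ?_ ?_) z hz
  · refine le_ciInf fun w => ?_
    rw [norm_sub_rev, norm_sub_rev y]
    exact hmin w w.2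
  · exact ciInf_le (f := fun w : K => ‖y - w‖) ⟨0, by rintro _ ⟨w, rfl⟩; positivity⟩ ⟨_, hp⟩

theorem norm_proj_sub_sq_le {K : Set (Vec d)} (hK : IsClosed K) (hne : K.Nonempty)
    (hc : Convex ℝ K) (y : Vec d) {z : Vec d} (hz : z ∈ K) :
    ‖proj K y - z‖ ^ 2 ≤ ‖y - z‖ ^ 2 - ‖proj K y - y‖ ^ 2 := by
  have h := inner_sub_proj_le_zero hK hne hc y hz
  have e : y - z = (y - proj K y) - (z - proj K y) := by abel
  have e' := norm_sub_sq_real (y - proj K y) (z - proj K y)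
  rw [← e, norm_sub_rev z, norm_sub_rev y (proj K y)] at e'
  linarith

theorem norm_proj_sub_proj_le {K : Set (Vec d)} (hK : IsClosed K) (hne : K.Nonempty)
    (hc : Convex ℝ K) (y z : Vec d) : ‖proj K y - proj K z‖ ≤ ‖y - z‖ := by
  have h1 := inner_sub_proj_le_zero hK hne hc y (proj_spec hK hne z).1
  have h2 := inner_sub_proj_le_zero hK hne hc z (proj_spec hK hne y).1
  have h3 := real_inner_le_norm (y - z) (proj K y - proj K z)
  have h4 : ‖proj K y - proj K z‖ ^ 2 ≤ inner ℝ (y - z) (proj K y - proj K z) := by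
    rw [← real_inner_self_eq_norm_sq]
    have e : inner ℝ (y - z) (proj K y - proj K z)
        = inner ℝ (proj K y - proj K z) (proj K y - proj K z)
          - inner ℝ (y - proj K y) (proj K z - proj K y)
          - inner ℝ (z - proj K z) (proj K y - proj K z) := by
      simp only [inner_sub_left, inner_sub_right]; ring
    linarith
  rcases (norm_nonneg (proj K y - proj K z)).eq_or_lt with h | h
  · rw [← h]; positivity
  · nlinarith

theorem continuous_proj {K : Set (Vec d)} (hK : IsClosed K) (hne : K.Nonempty)
    (hc : Convex ℝ K) : Continuous (proj K) :=
  (LipschitzWith.of_dist_le_mul (K := 1) fun y z => by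
    simpa [dist_eq_norm] using norm_proj_sub_proj_le hK hne hc y z).continuous

theorem proj_of_mem {K : Set (Vec d)} (hK : IsClosed K) {y : Vec d} (hy : y ∈ K) :
    proj K y = y := by
  have h := (proj_spec hK ⟨y, hy⟩ y).2 y hy
  rw [sub_self, norm_zero, norm_le_zero_iff, sub_eq_zero] at h
  exact h

theorem add_inner_gradient_le {f : Vec d → ℝ} (hf : ConvexOn ℝ univ f) {x : Vec d}
    (hx : DifferentiableAt ℝ f x) (y : Vec d) :
    f x + inner ℝ (gradient f x) (y - x) ≤ f y := by
  have hline : ConvexOn ℝ univ fun τ : ℝ => f (x + τ • (y - x)) := by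
    refine ⟨convex_univ, fun τ₁ _ τ₂ _ a b ha hb hab => ?_⟩
    have h := hf.2 (mem_univ (x + τ₁ • (y - x))) (mem_univ (x + τ₂ • (y - x))) ha hb hab
    have hb' : b = 1 - a := by linarith
    subst hb'
    rwa [show a • (x + τ₁ • (y - x)) + (1 - a) • (x + τ₂ • (y - x)) =
      x + (a • τ₁ + (1 - a) • τ₂) • (y - x) by simp only [smul_eq_mul]; module] at h
  have hder : HasDerivAt (fun τ : ℝ => f (x + τ • (y - x))) (inner ℝ (gradient f x) (y - x)) 0 := by
    have h1 := hx.hasGradientAt.hasFDerivAt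
    have h2 : HasDerivAt (fun τ : ℝ => x + τ • (y - x)) (y - x) 0 := by
      simpa using ((hasDerivAt_id (0 : ℝ)).smul_const (y - x)).const_add x
    have h3 : HasFDerivAt f (InnerProductSpace.toDual ℝ (Vec d) (gradient f x))
        (x + (0 : ℝ) • (y - x)) := by rwa [zero_smul, add_zero]
    exact h3.comp_hasDerivAt (0 : ℝ) h2
  have h := hline.le_slope_of_hasDerivAt (mem_univ 0) (mem_univ 1) one_pos hder
  rw [slope_def_field] at h
  simp only [zero_smul, add_zero, one_smul, add_sub_cancel, sub_zero, div_one] at h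
  linarith

/-- A one-sided Lipschitz bound: only the gradient at x enters, so in the applications y need not
lie in the action set. -/
theorem sub_le_gradient_bound {f : Vec d → ℝ} (hf : ConvexOn ℝ univ f) {x : Vec d}
    (hx : DifferentiableAt ℝ f x) (y : Vec d) :
    f x - f y ≤ ‖gradient f x‖ * ‖x - y‖ := by
  have h1 := add_inner_gradient_le hf hx y
  have h2 := neg_le_of_abs_le (abs_real_inner_le_norm (gradient f x) (y - x))
  rw [norm_sub_rev y x] at h2
  linarith

namespace Assumptions

variable {I : Problem d N} {T : ℕ} {F G r R η γ : ℝ}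

theorem R_pos (A : Assumptions I T F G r R η γ) : 0 < R := A.r_pos.trans_le A.r_le

theorem zero_mem (A : Assumptions I T F G r R η γ) : (0 : Vec d) ∈ I.X :=
  A.ball_subset (by simpa using A.r_pos.le)

theorem norm_le (A : Assumptions I T F G r R η γ) {x : Vec d} (hx : x ∈ I.X) : ‖x‖ ≤ R := by
  simpa using A.subset_ball hx

theorem norm_sub_le (A : Assumptions I T F G r R η γ) {x y : Vec d} (hx : x ∈ I.X)
    (hy : y ∈ I.X) : ‖x - y‖ ≤ 2 * R := by
  have := _root_.norm_sub_le x y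
  linarith [A.norm_le hx, A.norm_le hy]

theorem convex_shrunk (A : Assumptions I T F G r R η γ) : Convex ℝ ((1 - γ) • I.X) :=
  A.convex_X.smul _

theorem closed_shrunk (A : Assumptions I T F G r R η γ) (hγ : γ < 1) :
    IsClosed ((1 - γ) • I.X) :=
  A.closed_X.smul_of_ne_zero (by linarith)

theorem nonempty_shrunk (A : Assumptions I T F G r R η γ) : ((1 - γ) • I.X).Nonempty :=
  ⟨_, smul_mem_smul_set A.zero_mem⟩

/-- With x = (1-γ)z, the point x + δv is the convex combination of z and (δ/γ)v with weights 1-γ and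
γ, and δ/γ ≤ r puts the latter in the inner ball. -/
theorem add_smul_mem (A : Assumptions I T F G r R η γ) (hγ : γ < 1) {δ : ℝ} (hδ : 0 < δ)
    (hδγ : δ ≤ γ * r) {x v : Vec d} (hx : x ∈ (1 - γ) • I.X) (hv : ‖v‖ ≤ 1) :
    x + δ • v ∈ I.X := by
  obtain ⟨z, hz, rfl⟩ := hx
  have hγ0 : 0 < γ := by
    by_contra h
    nlinarith [A.r_pos]
  have hv' : (δ / γ) • v ∈ I.X := by
    refine A.ball_subset ?_
    rw [mem_closedBall_zero_iff, norm_smul, Real.norm_eq_abs, abs_of_pos (by positivity)]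
    calc δ / γ * ‖v‖ ≤ δ / γ * 1 := by gcongr
      _ ≤ r := by rw [mul_one, div_le_iff₀ hγ0]; linarith
  have := A.convex_X hz hv' (by linarith : 0 ≤ 1 - γ) hγ0.le (by ring)
  rwa [smul_smul, mul_div_cancel₀ _ hγ0.ne'] at this

theorem shrunk_subset (A : Assumptions I T F G r R η γ) (hγ0 : 0 ≤ γ) (hγ : γ < 1) :
    (1 - γ) • I.X ⊆ I.X := by
  rintro _ ⟨z, hz, rfl⟩
  exact A.convex_X.smul_mem_of_zero_mem A.zero_mem hz ⟨by linarith, by linarith⟩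

theorem norm_le_of_mem_shrunk (A : Assumptions I T F G r R η γ) (hγ : γ < 1) {x : Vec d}
    (hx : x ∈ (1 - γ) • I.X) : ‖x‖ ≤ (1 - γ) * R := by
  obtain ⟨z, hz, rfl⟩ := hx
  rw [norm_smul, Real.norm_eq_abs, abs_of_pos (by linarith)]
  exact mul_le_mul_of_nonneg_left (A.norm_le hz) (by linarith)

theorem continuous_f (A : Assumptions I T F G r R η γ) {t : ℕ} (ht : t ∈ Finset.Icc 1 T) :
    Continuous (I.f t) := (A.convex_f t ht).locallyLipschitz.continuous

theorem continuous_g (A : Assumptions I T F G r R η γ) {t : ℕ} (ht : t ∈ Finset.Icc 1 T)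
    (n : Fin N) : Continuous fun x => I.g t x n := (A.convex_g t ht n).locallyLipschitz.continuous

theorem f_sub_le (A : Assumptions I T F G r R η γ) {t : ℕ} (ht : t ∈ Finset.Icc 1 T)
    {x : Vec d} (hx : x ∈ I.X) (y : Vec d) : I.f t x - I.f t y ≤ G * ‖x - y‖ :=
  (sub_le_gradient_bound (A.convex_f t ht) (A.diff_f t ht x hx) y).trans
    (by gcongr; exact A.grad_f t ht x hx)

theorem le_g (A : Assumptions I T F G r R η γ) {t : ℕ} (ht : t ∈ Finset.Icc 1 T) (n : Fin N)
    {x : Vec d} (hx : x ∈ I.X) (y : Vec d) :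
    I.g t x n + inner ℝ (I.gradG t n x) (y - x) ≤ I.g t y n :=
  add_inner_gradient_le (A.convex_g t ht n) (A.diff_g t ht n x hx) y

theorem g_sub_le (A : Assumptions I T F G r R η γ) {t : ℕ} (ht : t ∈ Finset.Icc 1 T) (n : Fin N)
    {x : Vec d} (hx : x ∈ I.X) (y : Vec d) :
    I.g t x n - I.g t y n ≤ ‖I.gradG t n x‖ * ‖x - y‖ :=
  sub_le_gradient_bound (A.convex_g t ht n) (A.diff_g t ht n x hx) y

theorem F_nonneg (A : Assumptions I T F G r R η γ) {t : ℕ} (ht : t ∈ Finset.Icc 1 T) : 0 ≤ F :=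
  (abs_nonneg _).trans (A.bound_f t ht 0 A.zero_mem)

theorem G_nonneg (A : Assumptions I T F G r R η γ) {t : ℕ} (ht : t ∈ Finset.Icc 1 T) : 0 ≤ G :=
  (norm_nonneg _).trans (A.grad_f t ht 0 A.zero_mem)

end Assumptions

theorem Admissible.gamma_pos {I : Problem d N} {p : Params d} {r : ℝ} (B : Admissible I p r)
    (hr : 0 < r) : 0 < p.γ := by
  by_contra h
  nlinarith [B.delta_le, B.delta_pos]

theorem dual_one (I : Problem d N) (p : Params d) (u : ℕ → Vec d) : dual I p u 1 = 0 := rfl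

theorem xhat_succ (I : Problem d N) (p : Params d) (u : ℕ → Vec d) {t : ℕ} (ht : 1 ≤ t) :
    xhat I p u (t + 1) = primalStep I p t (xhat I p u t) (dual I p u t) (u t) := by
  obtain ⟨k, rfl⟩ := Nat.exists_eq_add_of_le' ht
  rfl

theorem dual_succ (I : Problem d N) (p : Params d) (u : ℕ → Vec d) {t : ℕ} (ht : 1 ≤ t) :
    dual I p u (t + 1) = dualStep I p t (xhat I p u t) (xhat I p u (t + 1)) (dual I p u t) := by
  obtain ⟨k, rfl⟩ := Nat.exists_eq_add_of_le' ht
  rfl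

theorem dual_nonneg (I : Problem d N) (p : Params d) (u : ℕ → Vec d) (t : ℕ) (n : Fin N) :
    0 ≤ dual I p u t n := by
  match t with
  | 0 => exact le_rfl
  | 1 => exact le_rfl
  | t + 2 => rw [dual_succ I p u (by omega)]; exact le_max_right _ _

variable {I : Problem d N} {p : Params d} {T : ℕ} {F G r R η : ℝ}

theorem xhat_mem (A : Assumptions I T F G r R η p.γ) (B : Admissible I p r) (u : ℕ → Vec d)
    (t : ℕ) : xhat I p u t ∈ (1 - p.γ) • I.X := by
  match t with
  | 0 => exact B.init_mem
  | 1 => exact B.init_mem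
  | t + 2 =>
    rw [xhat_succ I p u (by omega)]
    exact (proj_spec (A.closed_shrunk B.gamma_lt) A.nonempty_shrunk _).1

theorem xhat_mem_X (A : Assumptions I T F G r R η p.γ) (B : Admissible I p r) (u : ℕ → Vec d)
    (t : ℕ) : xhat I p u t ∈ I.X :=
  A.shrunk_subset (B.gamma_pos A.r_pos).le B.gamma_lt (xhat_mem A B u t)

theorem action_mem (A : Assumptions I T F G r R η p.γ) (B : Admissible I p r) {u : ℕ → Vec d}
    (hu : ∀ t, ‖u t‖ = 1) (t : ℕ) : action I p u t ∈ I.X :=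
  A.add_smul_mem B.gamma_lt B.delta_pos B.delta_le (xhat_mem A B u t) (hu t).le

theorem norm_directions {Ω : Type*} (u : ℕ → Ω → sphere (0 : Vec d) 1) (ω : Ω) (t : ℕ) :
    ‖directions u ω t‖ = 1 := by simp [directions]

theorem dual_le_dualMax (I : Problem d N) (p : Params d) (u : ℕ → Vec d) {t T : ℕ}
    (ht : t ∈ Finset.Icc 1 (T + 1)) : ‖dual I p u t‖ ≤ dualMax I p u T :=
  Finset.le_sup' (fun t => ‖dual I p u t‖) ht

theorem dualMax_nonneg (I : Problem d N) (p : Params d) (u : ℕ → Vec d) (T : ℕ) :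
    0 ≤ dualMax I p u T :=
  (norm_nonneg _).trans (dual_le_dualMax I p u (t := 1) (by simp))

end

/-! ### Analysis along a fixed realization of the directions. -/

section

variable {d N : ℕ}

theorem norm_le_sum_of_nonneg {v : EuclideanSpace ℝ (Fin N)} (hv : ∀ n, 0 ≤ v n) :
    ‖v‖ ≤ ∑ n, v n := by
  have hs : 0 ≤ ∑ n, v n := Finset.sum_nonneg fun n _ => hv n
  refine abs_le_of_sq_le_sq' ?_ hs |>.2
  rw [EuclideanSpace.real_norm_sq_eq, sq (∑ n, v n), Finset.sum_mul]
  refine Finset.sum_le_sum fun n _ => ?_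
  rw [sq]
  exact mul_le_mul_of_nonneg_left (Finset.single_le_sum (fun m _ => hv m) (Finset.mem_univ n)) (hv n)

theorem norm_le_add_sqrt_mul {a b : EuclideanSpace ℝ (Fin N)} {c : ℝ} (hc : 0 ≤ c)
    (ha : ∀ n, 0 ≤ a n) (hab : ∀ n, a n ≤ b n + c) : ‖a‖ ≤ ‖b‖ + √N * c := by
  let e : EuclideanSpace ℝ (Fin N) := WithLp.toLp 2 fun _ => c
  have he : ‖e‖ = √N * c := by
    rw [EuclideanSpace.norm_eq]
    simp [e, Real.sqrt_mul, Real.sqrt_sq hc]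
  have h1 : ‖a‖ ≤ ‖b + e‖ := by
    refine abs_le_of_sq_le_sq' ?_ (norm_nonneg _) |>.2
    rw [EuclideanSpace.real_norm_sq_eq, EuclideanSpace.real_norm_sq_eq]
    exact Finset.sum_le_sum fun n _ => pow_le_pow_left₀ (ha n) (hab n) 2
  exact h1.trans ((norm_add_le b e).trans_eq (by rw [he]))

theorem sum_mul_le_norm_mul {v : EuclideanSpace ℝ (Fin N)} {w : Fin N → ℝ} {J : ℝ} (hJ : 0 ≤ J)
    (hw : ∑ n, w n ^ 2 ≤ J ^ 2) : ∑ n, v n * w n ≤ ‖v‖ * J := by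
  have h := Finset.sum_mul_sq_le_sq_mul_sq Finset.univ (fun n => v n) w
  rw [← EuclideanSpace.real_norm_sq_eq] at h
  refine abs_le_of_sq_le_sq' ?_ (by positivity) |>.2
  rw [mul_pow]
  exact h.trans (by gcongr)

theorem norm_sum_smul_le {v : EuclideanSpace ℝ (Fin N)} (hv : ∀ n, 0 ≤ v n) {w : Fin N → Vec d}
    {J : ℝ} (hJ : 0 ≤ J) (hw : ∑ n, ‖w n‖ ^ 2 ≤ J ^ 2) : ‖∑ n, v n • w n‖ ≤ ‖v‖ * J := by
  refine (norm_sum_le _ _).trans ?_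
  simp only [norm_smul, Real.norm_eq_abs, abs_of_nonneg (hv _)]
  exact sum_mul_le_norm_mul hJ hw

theorem sum_Icc_one {M : Type*} [AddCommMonoid M] (a : ℕ → M) (T : ℕ) :
    ∑ t ∈ Finset.Icc 1 T, a t = ∑ t ∈ Finset.range T, a (t + 1) := by
  induction T with
  | zero => simp
  | succ k ih => rw [Finset.sum_Icc_succ_top (by omega), ih, Finset.sum_range_succ]

/-- Drift of one coordinate of the dual iterate; the increment is clipped at `-b`. -/
theorem sq_max_add_mul_le {lam μ lin a b e : ℝ} (hlam : 0 ≤ lam) (hμ : 0 < μ) (hb : 0 ≤ b)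
    (h1 : lin ≤ b) (h2 : lin ≤ a + e) (h3 : -b ≤ a + e) :
    (max (lam + μ * lin) 0) ^ 2 ≤ lam ^ 2 + 2 * μ * (lam * (a + e)) + μ ^ 2 * b ^ 2 := by
  -- No lower bound on `lin` is available, so its square is uncontrolled. Raising it to -b keeps it
  -- below a + e, can only enlarge the updated multiplier, and makes its square at most b².
  set c := max lin (-b) with hc
  have hc2 : c ^ 2 ≤ b ^ 2 :=
    sq_le_sq.2 (by rw [abs_of_nonneg hb, abs_le]; exact ⟨le_max_right _ _, max_le h1 (by linarith)⟩)
  have hce : c ≤ a + e := max_le h2 h3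
  have hsq : (max (lam + μ * lin) 0) ^ 2 ≤ (lam + μ * c) ^ 2 := by
    rcases le_total (lam + μ * lin) 0 with h | h
    · rw [max_eq_right h, zero_pow two_ne_zero]; positivity
    · rw [max_eq_left h]
      have : lin ≤ c := le_max_left _ _
      gcongr
  calc _ ≤ (lam + μ * c) ^ 2 := hsq
    _ = lam ^ 2 + 2 * μ * (lam * c) + μ ^ 2 * c ^ 2 := by ring
    _ ≤ _ := by gcongr

/-- Abel summation for moving comparators. Letting ‖y‖² telescope separately leaves the increments
of y paired with x alone, so that ‖x‖ ≤ R, rather than the diameter 2R, multiplies the path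
variation. -/
theorem sum_norm_sq_sub_eq {E : Type*} [NormedAddCommGroup E] [InnerProductSpace ℝ E]
    (x y : ℕ → E) (T : ℕ) :
    ∑ t ∈ Finset.range T, (‖x (t + 1) - y (t + 1)‖ ^ 2 - ‖x (t + 2) - y (t + 1)‖ ^ 2) =
      ‖x 1 - y 0‖ ^ 2 - ‖y 0‖ ^ 2 - ‖x (T + 1) - y T‖ ^ 2 + ‖y T‖ ^ 2
        - 2 * ∑ t ∈ Finset.range T, inner ℝ (y (t + 1) - y t) (x (t + 1)) := by
  induction T with
  | zero => simp
  | succ k ih =>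
    rw [Finset.sum_range_succ, ih, Finset.sum_range_succ]
    simp only [norm_sub_sq_real, inner_sub_left, real_inner_comm (y k) (x (k + 1)),
      real_inner_comm (y (k + 1)) (x (k + 1))]
    ring

variable {I : Problem d N} {p : Params d} {T : ℕ} {F G r R η : ℝ}

theorem norm_onePoint_le (A : Assumptions I T F G r R η p.γ) (B : Admissible I p r)
    {t : ℕ} (ht : t ∈ Finset.Icc 1 T) {x v : Vec d} (hx : x ∈ (1 - p.γ) • I.X) (hv : ‖v‖ = 1) :
    ‖onePoint p.δ (I.f t) x v‖ ≤ d * F / p.δ := by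
  have hδ := B.delta_pos
  rw [onePoint, norm_smul, hv, mul_one, norm_mul, norm_div, Real.norm_eq_abs p.δ, abs_of_pos hδ,
    Real.norm_natCast]
  have : ‖I.f t (x + p.δ • v)‖ ≤ F :=
    A.bound_f t ht _ (A.add_smul_mem B.gamma_lt hδ B.delta_le hx hv.le)
  calc _ ≤ d / p.δ * F := by gcongr
    _ = _ := by ring

/-- The constraint gradients stay tested at the new iterate, which is where the dual update
evaluates its linearization. Only the loss estimate is moved back to the old iterate, so the
quadratic error contains no ‖λ‖². -/
theorem primal_step_le (A : Assumptions I T F G r R η p.γ) (B : Admissible I p r)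
    {u : ℕ → Vec d} (hu : ∀ t, ‖u t‖ = 1) {t : ℕ} (ht : t ∈ Finset.Icc 1 T) {y : Vec d}
    (hy : y ∈ (1 - p.γ) • I.X) :
    inner ℝ (onePoint p.δ (I.f t) (xhat I p u t) (u t)) (xhat I p u t - y)
      + ∑ n, dual I p u t n *
          inner ℝ (I.gradG t n (xhat I p u t)) (xhat I p u (t + 1) - y) ≤
      (‖xhat I p u t - y‖ ^ 2 - ‖xhat I p u (t + 1) - y‖ ^ 2) / (2 * p.α)
        + p.α * (d * F / p.δ) ^ 2 / 2 := by
  have hα := B.alpha_pos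
  have hnorm := norm_onePoint_le A B ht (xhat_mem A B u t) (hu t)
  have hx' := xhat_succ I p u (Finset.mem_Icc.1 ht).1
  rw [primalStep] at hx'
  set x := xhat I p u t
  set v := lagrangianGrad I p t x (dual I p u t) (u t) with hv
  have hproj := norm_proj_sub_sq_le (A.closed_shrunk B.gamma_lt) A.nonempty_shrunk
    A.convex_shrunk (x - p.α • v) hy
  rw [← hx'] at hproj
  set x' := xhat I p u (t + 1)
  set g := onePoint p.δ (I.f t) x (u t) with hg
  have hvin : inner ℝ v (x' - y) = inner ℝ g (x - y) + inner ℝ g (x' - x)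
      + ∑ n, dual I p u t n * inner ℝ (I.gradG t n x) (x' - y) := by
    rw [hv, lagrangianGrad, inner_add_left, sum_inner, ← hg, ← inner_add_right]
    simp only [inner_smul_left, RCLike.conj_to_real, sub_add_sub_cancel']
  have e1 : ‖x - p.α • v - y‖ ^ 2 - ‖x' - (x - p.α • v)‖ ^ 2
      = ‖x - y‖ ^ 2 - 2 * p.α * inner ℝ v (x' - y) - ‖x' - x‖ ^ 2 := by
    rw [show x - p.α • v - y = (x - y) - p.α • v by abel,
      show x' - (x - p.α • v) = (x' - x) + p.α • v by abel, norm_sub_sq_real, norm_add_sq_real,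
      inner_smul_right, inner_smul_right, real_inner_comm v (x - y), real_inner_comm v (x' - x),
      show x' - y = (x' - x) + (x - y) by abel, inner_add_right v]
    ring
  -- Completing the square: the -‖x' - x‖² left by the projection absorbs the cost of replacing x'
  -- by x in ⟨g, ·⟩, up to α²‖g‖².
  have e2 : 0 ≤ ‖p.α • g + (x' - x)‖ ^ 2 := by positivity
  rw [norm_add_sq_real, inner_smul_left, norm_smul, mul_pow, RCLike.conj_to_real,
    Real.norm_eq_abs, sq_abs] at e2
  have e3 : ‖g‖ ^ 2 ≤ (d * F / p.δ) ^ 2 := by gcongr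
  have e4 : p.α ^ 2 * ‖g‖ ^ 2 ≤ p.α ^ 2 * (d * F / p.δ) ^ 2 := by gcongr
  rw [← sub_nonneg]
  have e5 : 0 ≤ (2 * p.α)⁻¹ * ((‖x - y‖ ^ 2 - ‖x' - y‖ ^ 2) + p.α ^ 2 * (d * F / p.δ) ^ 2
      - 2 * p.α * (inner ℝ v (x' - y) - inner ℝ g (x' - x))) := by
    refine mul_nonneg (by positivity) ?_
    linarith
  rw [hvin] at e5
  convert e5 using 1
  generalize (d * F / p.δ) ^ 2 = q
  field_simp
  ring

/-- By convexity the linearization at x̂ satisfies g(x̂) + ⟨∇g(x̂), x̂' - x̂⟩ ≤ g(y) + ⟨∇g(x̂), x̂'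
- y⟩, which produces the coupling sum of `primal_step_le`. Here e bounds the constraints at the
comparator and b is the clipping level. -/
theorem dual_step_le (A : Assumptions I T F G r R η p.γ) (hμ : 0 < p.μ) (u : ℕ → Vec d) {t : ℕ}
    (ht : t ∈ Finset.Icc 1 T) (y : Vec d) (hx : xhat I p u t ∈ I.X)
    {b e : Fin N → ℝ} (hb : ∀ n, 0 ≤ b n) (he : ∀ n, I.g t y n ≤ e n)
    (h1 : ∀ n, I.g t (xhat I p u t) n + inner ℝ (I.gradG t n (xhat I p u t))
      (xhat I p u (t + 1) - xhat I p u t) ≤ b n)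
    (h2 : ∀ n, -b n ≤ inner ℝ (I.gradG t n (xhat I p u t)) (xhat I p u (t + 1) - y) + e n) :
    (‖dual I p u (t + 1)‖ ^ 2 - ‖dual I p u t‖ ^ 2) / (2 * p.μ) ≤
      ∑ n, dual I p u t n * inner ℝ (I.gradG t n (xhat I p u t)) (xhat I p u (t + 1) - y)
        + ∑ n, dual I p u t n * e n + p.μ / 2 * ∑ n, b n ^ 2 := by
  have hsum : ‖dual I p u (t + 1)‖ ^ 2 ≤ ∑ n, (dual I p u t n ^ 2 + 2 * p.μ *
      (dual I p u t n * (inner ℝ (I.gradG t n (xhat I p u t)) (xhat I p u (t + 1) - y) + e n))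
        + p.μ ^ 2 * b n ^ 2) := by
    rw [EuclideanSpace.real_norm_sq_eq, dual_succ I p u (Finset.mem_Icc.1 ht).1]
    refine Finset.sum_le_sum fun n _ => ?_
    refine sq_max_add_mul_le (dual_nonneg I p u t n) hμ (hb n) (h1 n) ?_ (h2 n)
    have h3 := A.le_g ht n hx y
    have h4 := he n
    simp only [inner_sub_right] at h3 ⊢
    linarith
  simp only [Finset.sum_add_distrib, ← Finset.mul_sum, mul_add] at hsum
  rw [← EuclideanSpace.real_norm_sq_eq] at hsum
  rw [div_le_iff₀ (by positivity)]
  linarith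

/-- No upper bound on g is assumed; one for the linearization comes from the Slater point s, since
it is at most g(s) + ⟨∇g(x̂), x̂' - s⟩ and s lies within 2R of x̂'. -/
theorem linearized_constraint_le (A : Assumptions I T F G r R η p.γ) (B : Admissible I p r)
    (u : ℕ → Vec d) {t : ℕ} (ht : t ∈ Finset.Icc 1 T) (n : Fin N) :
    I.g t (xhat I p u t) n + inner ℝ (I.gradG t n (xhat I p u t))
      (xhat I p u (t + 1) - xhat I p u t) ≤ 2 * R * ‖I.gradG t n (xhat I p u t)‖ - η := by
  obtain ⟨s, hs, hsη⟩ := A.slater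
  have hsX := A.shrunk_subset (B.gamma_pos A.r_pos).le B.gamma_lt hs
  have hx := xhat_mem_X A B u t
  have h1 := A.le_g ht n hx s
  have h2 := real_inner_le_norm (I.gradG t n (xhat I p u t)) (xhat I p u (t + 1) - s)
  have h3 := A.norm_sub_le (xhat_mem_X A B u (t + 1)) hsX
  have h4 : ‖I.gradG t n (xhat I p u t)‖ * ‖xhat I p u (t + 1) - s‖ ≤
    ‖I.gradG t n (xhat I p u t)‖ * (2 * R) := by gcongr
  rw [show xhat I p u (t + 1) - s = (xhat I p u (t + 1) - xhat I p u t) - (s - xhat I p u t) by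
      abel, inner_sub_right] at h2
  rw [show xhat I p u (t + 1) - s = (xhat I p u (t + 1) - xhat I p u t) - (s - xhat I p u t) by
      abel] at h4
  linarith [hsη t ht n]

theorem neg_le_inner_gradG (A : Assumptions I T F G r R η p.γ) (B : Admissible I p r)
    (u : ℕ → Vec d) (t : ℕ) (n : Fin N) {y : Vec d} (hy : y ∈ I.X) :
    -(2 * R * ‖I.gradG t n (xhat I p u t)‖) ≤
      inner ℝ (I.gradG t n (xhat I p u t)) (xhat I p u (t + 1) - y) := by
  have h2 := neg_le_of_abs_le
    (abs_real_inner_le_norm (I.gradG t n (xhat I p u t)) (xhat I p u (t + 1) - y))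
  have h3 := A.norm_sub_le (xhat_mem_X A B u (t + 1)) hy
  have h4 : ‖I.gradG t n (xhat I p u t)‖ * ‖xhat I p u (t + 1) - y‖ ≤
    ‖I.gradG t n (xhat I p u t)‖ * (2 * R) := by gcongr
  linarith

/-- One slot of the regret analysis, against the shrunken copy of a feasible point `z`. -/
theorem slot_regret_le (A : Assumptions I T F G r R η p.γ) (B : Admissible I p r)
    {u : ℕ → Vec d} (hu : ∀ t, ‖u t‖ = 1) {t : ℕ} (ht : t ∈ Finset.Icc 1 T) {z : Vec d}
    (hz : z ∈ I.X) (hgz : ∀ n, I.g t z n ≤ 0) {J : ℝ} (hJ : 0 ≤ J)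
    (hJg : ∀ x ∈ I.X, ∑ n, ‖I.gradG t n x‖ ^ 2 ≤ J ^ 2) :
    inner ℝ (onePoint p.δ (I.f t) (xhat I p u t) (u t)) (xhat I p u t - (1 - p.γ) • z)
        + (‖dual I p u (t + 1)‖ ^ 2 - ‖dual I p u t‖ ^ 2) / (2 * p.μ) ≤
      (‖xhat I p u t - (1 - p.γ) • z‖ ^ 2 - ‖xhat I p u (t + 1) - (1 - p.γ) • z‖ ^ 2) / (2 * p.α)
        + p.α * (d * F / p.δ) ^ 2 / 2 + p.γ * R * (J * ‖dual I p u t‖)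
        + 2 * p.μ * J ^ 2 * R ^ 2 := by
  have hγ := B.gamma_pos A.r_pos
  have hR := A.R_pos
  have hμ := B.mu_pos
  have hyK : (1 - p.γ) • z ∈ (1 - p.γ) • I.X := smul_mem_smul_set hz
  have hyX := A.shrunk_subset hγ.le B.gamma_lt hyK
  have hx := xhat_mem_X A B u t
  have h1 := primal_step_le A B hu ht hyK
  set y := (1 - p.γ) • z with hy
  have hzy : ‖y - z‖ ≤ p.γ * R := by
    rw [show y - z = -(p.γ • z) by rw [hy]; module, norm_neg, norm_smul, Real.norm_eq_abs,
      abs_of_pos hγ]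
    exact mul_le_mul_of_nonneg_left (A.norm_le hz) hγ.le
  -- The shrunken point y may violate the constraints, but it is within γR of the feasible z; e is
  -- the resulting violation bound.
  have h2 := dual_step_le A hμ u ht y hx
    (b := fun n => 2 * R * ‖I.gradG t n (xhat I p u t)‖)
    (e := fun n => p.γ * R * ‖I.gradG t n y‖)
    (fun n => by positivity)
    (fun n => by
      have h3 := A.g_sub_le ht n hyX z
      have h4 : ‖I.gradG t n y‖ * ‖y - z‖ ≤ ‖I.gradG t n y‖ * (p.γ * R) := by gcongr
      linarith [hgz n])
    (fun n => by linarith [linearized_constraint_le A B u ht n, A.eta_pos])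
    (fun n => by
      have h3 := neg_le_inner_gradG A B u t n hyX
      have h4 : 0 ≤ p.γ * R * ‖I.gradG t n y‖ := by positivity
      linarith)
  have h3 : ∑ n, dual I p u t n * (p.γ * R * ‖I.gradG t n y‖) ≤
      p.γ * R * (J * ‖dual I p u t‖) := by
    have := sum_mul_le_norm_mul (v := dual I p u t) hJ (hJg y hyX)
    calc _ = p.γ * R * ∑ n, dual I p u t n * ‖I.gradG t n y‖ := by
          rw [Finset.mul_sum]; exact Finset.sum_congr rfl fun n _ => by ring
      _ ≤ p.γ * R * (‖dual I p u t‖ * J) := by gcongr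
      _ = _ := by ring
  have h4 : p.μ / 2 * ∑ n, (2 * R * ‖I.gradG t n (xhat I p u t)‖) ^ 2 ≤
      2 * p.μ * J ^ 2 * R ^ 2 := by
    calc _ = 2 * p.μ * R ^ 2 * ∑ n, ‖I.gradG t n (xhat I p u t)‖ ^ 2 := by
          rw [Finset.mul_sum, Finset.mul_sum]; exact Finset.sum_congr rfl fun n _ => by ring
      _ ≤ 2 * p.μ * R ^ 2 * J ^ 2 := by gcongr; exact hJg _ hx
      _ = _ := by ring
  linarith

/-- Drift of the Lyapunov function `‖λ‖² / (2μ) + ‖x - s‖² / (2α)` for a Slater point `s`. -/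
theorem slot_drift_le (A : Assumptions I T F G r R η p.γ) (B : Admissible I p r)
    {u : ℕ → Vec d} (hu : ∀ t, ‖u t‖ = 1) {t : ℕ} (ht : t ∈ Finset.Icc 1 T) {s : Vec d}
    (hs : s ∈ (1 - p.γ) • I.X) (hgs : ∀ n, I.g t s n ≤ -η) :
    (‖dual I p u (t + 1)‖ ^ 2 - ‖dual I p u t‖ ^ 2) / (2 * p.μ)
        + (‖xhat I p u (t + 1) - s‖ ^ 2 - ‖xhat I p u t - s‖ ^ 2) / (2 * p.α) ≤
      -η * ‖dual I p u t‖
        - inner ℝ (onePoint p.δ (I.f t) (xhat I p u t) (u t)) (xhat I p u t - s)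
        + p.α * (d * F / p.δ) ^ 2 / 2 + p.μ / 2 * (N * (2 * R * G + η) ^ 2) := by
  have hR := A.R_pos
  have hη := A.eta_pos
  have hG := A.G_nonneg ht
  have hsX := A.shrunk_subset (B.gamma_pos A.r_pos).le B.gamma_lt hs
  have hx := xhat_mem_X A B u t
  have h1 := primal_step_le A B hu ht hs
  have hgrad : ∀ n, 2 * R * ‖I.gradG t n (xhat I p u t)‖ ≤ 2 * R * G := fun n => by
    gcongr; exact A.grad_g t ht n _ hx
  -- The extra η in b is needed because the lower bound must survive adding e = -η to an inner
  -- product that can reach -2RG.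
  have h2 := dual_step_le A B.mu_pos u ht s hx
    (b := fun _ => 2 * R * G + η) (e := fun _ => -η)
    (fun n => by positivity) hgs
    (fun n => by linarith [linearized_constraint_le A B u ht n, hgrad n])
    (fun n => by linarith [neg_le_inner_gradG A B u t n hsX, hgrad n])
  rw [← Finset.sum_mul] at h2
  have h3 := mul_le_mul_of_nonneg_right (norm_le_sum_of_nonneg (dual_nonneg I p u t)) hη.le
  simp only [Finset.sum_const, Finset.card_univ, Fintype.card_fin, nsmul_eq_mul] at h2
  have h4 : (‖xhat I p u (t + 1) - s‖ ^ 2 - ‖xhat I p u t - s‖ ^ 2) / (2 * p.α)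
    = -((‖xhat I p u t - s‖ ^ 2 - ‖xhat I p u (t + 1) - s‖ ^ 2) / (2 * p.α)) := by ring
  rw [h4]
  linarith

/-- The regret bound along a realization, for the linearized losses. -/
theorem sum_inner_onePoint_le (A : Assumptions I T F G r R η p.γ) (B : Admissible I p r)
    {u : ℕ → Vec d} (hu : ∀ t, ‖u t‖ = 1) {xs : ℕ → Vec d} (hxs : IsMinimizerPath I T xs)
    {J : ℝ} (hJ : 0 ≤ J)
    (hJg : ∀ t ∈ Finset.Icc 1 T, ∀ x ∈ I.X, ∑ n, ‖I.gradG t n x‖ ^ 2 ≤ J ^ 2) :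
    ∑ t ∈ Finset.Icc 1 T, inner ℝ (onePoint p.δ (I.f t) (xhat I p u t) (u t))
        (xhat I p u t - (1 - p.γ) • xs t) ≤
      R / p.α * variation xs T + (R ^ 2 + ‖p.x₁ - xs 0‖ ^ 2) / (2 * p.α)
        + T * (p.α * (d * F / p.δ) ^ 2 / 2) + p.γ * R * T * (J * dualMax I p u T)
        + 2 * p.μ * J ^ 2 * R ^ 2 * T := by
  have hγ := B.gamma_pos A.r_pos
  have hγ1 := B.gamma_lt
  have hR := A.R_pos
  have hα := B.alpha_pos
  have hμ := B.mu_pos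
  have hxsX : ∀ t ≤ T, xs t ∈ I.X := by
    intro t ht
    rcases Nat.eq_zero_or_pos t with rfl | h
    · exact hxs.1
    · exact (hxs.2 t (Finset.mem_Icc.2 ⟨h, ht⟩)).1.1
  let y : ℕ → Vec d := fun t => (1 - p.γ) • xs t
  let x : ℕ → Vec d := xhat I p u
  have hsum : ∑ t ∈ Finset.Icc 1 T, inner ℝ (onePoint p.δ (I.f t) (x t) (u t)) (x t - y t)
      + ∑ t ∈ Finset.Icc 1 T, (‖dual I p u (t + 1)‖ ^ 2 - ‖dual I p u t‖ ^ 2) / (2 * p.μ) ≤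
      ∑ t ∈ Finset.Icc 1 T, (‖x t - y t‖ ^ 2 - ‖x (t + 1) - y t‖ ^ 2) / (2 * p.α)
        + T * (p.α * (d * F / p.δ) ^ 2 / 2) + p.γ * R * T * (J * dualMax I p u T)
        + 2 * p.μ * J ^ 2 * R ^ 2 * T := by
    rw [← Finset.sum_add_distrib]
    have hslot : ∀ t ∈ Finset.Icc 1 T,
        inner ℝ (onePoint p.δ (I.f t) (x t) (u t)) (x t - y t)
        + (‖dual I p u (t + 1)‖ ^ 2 - ‖dual I p u t‖ ^ 2) / (2 * p.μ) ≤
        (‖x t - y t‖ ^ 2 - ‖x (t + 1) - y t‖ ^ 2) / (2 * p.α)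
        + (p.α * (d * F / p.δ) ^ 2 / 2 + p.γ * R * (J * dualMax I p u T)
        + 2 * p.μ * J ^ 2 * R ^ 2) := by
      intro t ht
      have h1 := slot_regret_le A B hu ht (hxs.2 t ht).1.1 (hxs.2 t ht).1.2 hJ (hJg t ht)
      have h2 : ‖dual I p u t‖ ≤ dualMax I p u T := dual_le_dualMax I p u (by
        rw [Finset.mem_Icc] at ht ⊢; omega)
      have h3 : p.γ * R * (J * ‖dual I p u t‖) ≤ p.γ * R * (J * dualMax I p u T) := by gcongr
      linarith
    refine (Finset.sum_le_sum hslot).trans_eq ?_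
    rw [Finset.sum_add_distrib, Finset.sum_const, Nat.card_Icc, Nat.add_sub_cancel, nsmul_eq_mul]
    ring
  have htel : ∑ t ∈ Finset.Icc 1 T, (‖dual I p u (t + 1)‖ ^ 2 - ‖dual I p u t‖ ^ 2) / (2 * p.μ)
      = ‖dual I p u (T + 1)‖ ^ 2 / (2 * p.μ) := by
    rw [← Finset.sum_div, sum_Icc_one,
      Finset.sum_range_sub (fun t => ‖dual I p u (t + 1)‖ ^ 2) T, dual_one]
    simp
  have hpos : 0 ≤ ‖dual I p u (T + 1)‖ ^ 2 / (2 * p.μ) := by positivity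
  have habel : ∑ t ∈ Finset.Icc 1 T, (‖x t - y t‖ ^ 2 - ‖x (t + 1) - y t‖ ^ 2) ≤
      R ^ 2 + ‖p.x₁ - xs 0‖ ^ 2 + 2 * R * variation xs T := by
    rw [sum_Icc_one, sum_norm_sq_sub_eq x y T]
    have hx1 : x 1 = p.x₁ := rfl
    have hvar : -∑ t ∈ Finset.range T, inner ℝ (y (t + 1) - y t) (x (t + 1))
        ≤ R * variation xs T := by
      rw [variation, ← Finset.sum_neg_distrib, Finset.mul_sum]
      refine Finset.sum_le_sum fun t _ => ?_
      have h1 := neg_le_of_abs_le (abs_real_inner_le_norm (y (t + 1) - y t) (x (t + 1)))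
      have h2 : ‖y (t + 1) - y t‖ ≤ ‖xs (t + 1) - xs t‖ := by
        rw [← smul_sub, norm_smul, Real.norm_eq_abs, abs_of_pos (by linarith)]
        exact mul_le_of_le_one_left (norm_nonneg _) (by linarith)
      have h3 : ‖x (t + 1)‖ ≤ R := A.norm_le (xhat_mem_X A B u _)
      have h4 : ‖y (t + 1) - y t‖ * ‖x (t + 1)‖ ≤ ‖xs (t + 1) - xs t‖ * R := by gcongr
      linarith
    have hyT : ‖y T‖ ^ 2 ≤ ((1 - p.γ) * R) ^ 2 := by
      gcongr
      exact A.norm_le_of_mem_shrunk hγ1 (smul_mem_smul_set (hxsX T le_rfl))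
    have hx1n : ‖p.x₁‖ ^ 2 ≤ ((1 - p.γ) * R) ^ 2 := by
      gcongr
      exact A.norm_le_of_mem_shrunk hγ1 B.init_mem
    -- Shrinking the reference point costs nothing: the square in `h1` leaves an excess γ²‖x₁‖² ≤
    -- γR², which fits in R² - (1-γ)²R².
    have h0 : ‖p.x₁ - y 0‖ ^ 2 - ‖y 0‖ ^ 2 + ((1 - p.γ) * R) ^ 2 ≤
        R ^ 2 + ‖p.x₁ - xs 0‖ ^ 2 := by
      have h1 : 0 ≤ ‖xs 0 - p.γ • p.x₁‖ ^ 2 := by positivity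
      rw [norm_sub_sq_real, inner_smul_right, norm_smul, Real.norm_eq_abs, abs_of_pos hγ,
        real_inner_comm] at h1
      simp only [y]
      rw [norm_sub_sq_real, norm_sub_sq_real, inner_smul_right]
      have h2 : p.γ ^ 2 * ‖p.x₁‖ ^ 2 ≤ p.γ ^ 2 * ((1 - p.γ) * R) ^ 2 := by gcongr
      have h3 : p.γ ^ 2 * ((1 - p.γ) * R) ^ 2 ≤ p.γ ^ 2 * R ^ 2 := by
        gcongr
        nlinarith
      have h4 : p.γ ^ 2 * R ^ 2 ≤ p.γ * R ^ 2 := by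
        gcongr
        nlinarith
      nlinarith
    rw [hx1]
    have : 0 ≤ ‖x (T + 1) - y T‖ ^ 2 := by positivity
    linarith
  have hdiv : ∑ t ∈ Finset.Icc 1 T, (‖x t - y t‖ ^ 2 - ‖x (t + 1) - y t‖ ^ 2) / (2 * p.α) ≤
      R / p.α * variation xs T + (R ^ 2 + ‖p.x₁ - xs 0‖ ^ 2) / (2 * p.α) := by
    rw [← Finset.sum_div]
    refine (div_le_div_of_nonneg_right habel (by positivity)).trans_eq ?_
    field_simp
    ring
  rw [htel] at hsum
  change ∑ t ∈ Finset.Icc 1 T, inner ℝ (onePoint p.δ (I.f t) (x t) (u t)) (x t - y t) ≤ _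
  linarith

theorem norm_xhat_succ_sub_le (A : Assumptions I T F G r R η p.γ) (B : Admissible I p r)
    {u : ℕ → Vec d} (hu : ∀ t, ‖u t‖ = 1) {t : ℕ} (ht : t ∈ Finset.Icc 1 T) {J : ℝ} (hJ : 0 ≤ J)
    (hJg : ∀ x ∈ I.X, ∑ n, ‖I.gradG t n x‖ ^ 2 ≤ J ^ 2) :
    ‖xhat I p u (t + 1) - xhat I p u t‖ ≤ p.α * (d * F / p.δ + ‖dual I p u t‖ * J) := by
  have hcl := A.closed_shrunk B.gamma_lt
  have h := norm_proj_sub_proj_le hcl A.nonempty_shrunk A.convex_shrunk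
    (xhat I p u t - p.α • lagrangianGrad I p t (xhat I p u t) (dual I p u t) (u t)) (xhat I p u t)
  rw [proj_of_mem hcl (xhat_mem A B u t), sub_sub_cancel_left, norm_neg, norm_smul,
    Real.norm_eq_abs, abs_of_pos B.alpha_pos] at h
  rw [xhat_succ I p u (Finset.mem_Icc.1 ht).1]
  refine h.trans (mul_le_mul_of_nonneg_left ?_ B.alpha_pos.le)
  exact (norm_add_le _ _).trans (add_le_add (norm_onePoint_le A B ht (xhat_mem A B u t) (hu t))
    (norm_sum_smul_le (dual_nonneg I p u t) hJ (hJg _ (xhat_mem_X A B u t))))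

/-- The bound on the fit along a realization. -/
theorem dynFit_le (A : Assumptions I T F G r R η p.γ) (B : Admissible I p r)
    {u : ℕ → Vec d} (hu : ∀ t, ‖u t‖ = 1) {J : ℝ} (hJ : 0 ≤ J)
    (hJg : ∀ t ∈ Finset.Icc 1 T, ∀ x ∈ I.X, ∑ n, ‖I.gradG t n x‖ ^ 2 ≤ J ^ 2)
    {β : ℝ} (hβ : 0 < β) :
    dynFit I p u T ≤ dualMax I p u T / p.μ + G ^ 2 * √N * T / (2 * β) + p.δ * G * √N * T
      + β * √N * T * (p.α ^ 2 * (d : ℝ) ^ 2 * F ^ 2 / p.δ ^ 2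
        + p.α ^ 2 * J ^ 2 * dualMax I p u T ^ 2) := by
  have hα := B.alpha_pos
  have hμ := B.mu_pos
  have hδ := B.delta_pos
  set q := G ^ 2 / (2 * β) + p.δ * G + β * (p.α ^ 2 * (d : ℝ) ^ 2 * F ^ 2 / p.δ ^ 2
        + p.α ^ 2 * J ^ 2 * dualMax I p u T ^ 2) with hq
  have hc : 0 ≤ T * q := by
    -- The sign of G is known only if there is a slot, so the empty horizon is separate.
    rcases Nat.eq_zero_or_pos T with h | h
    · simp [h]
    · have hG := A.G_nonneg (t := 1) (Finset.mem_Icc.2 ⟨le_rfl, h⟩)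
      positivity
  have hslot : ∀ t ∈ Finset.Icc 1 T, ∀ n, I.g t (action I p u t) n ≤
      (dual I p u (t + 1) n - dual I p u t n) / p.μ + q := by
    intro t ht n
    have hG := A.G_nonneg ht
    have hact := action_mem A B hu t
    have hx := xhat_mem_X A B u t
    have h1 := A.g_sub_le ht n hact (xhat I p u t)
    have h2 : ‖I.gradG t n (action I p u t)‖ * ‖action I p u t - xhat I p u t‖ ≤ G * p.δ := by
      rw [action, add_sub_cancel_left, norm_smul, hu, mul_one, Real.norm_eq_abs, abs_of_pos hδ]
      gcongr
      exact A.grad_g t ht n _ hact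
    have h3 : dual I p u t n + p.μ * (I.g t (xhat I p u t) n + inner ℝ
        (I.gradG t n (xhat I p u t)) (xhat I p u (t + 1) - xhat I p u t)) ≤
        dual I p u (t + 1) n := by
      rw [dual_succ I p u (Finset.mem_Icc.1 ht).1]
      exact le_max_left _ _
    have h4 : I.g t (xhat I p u t) n + inner ℝ
        (I.gradG t n (xhat I p u t)) (xhat I p u (t + 1) - xhat I p u t) ≤
        (dual I p u (t + 1) n - dual I p u t n) / p.μ := by
      rw [le_div_iff₀ hμ]; linarith
    have h5 := neg_le_of_abs_le (abs_real_inner_le_norm (I.gradG t n (xhat I p u t))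
      (xhat I p u (t + 1) - xhat I p u t))
    set Δ := ‖xhat I p u (t + 1) - xhat I p u t‖
    have h6 : ‖I.gradG t n (xhat I p u t)‖ * Δ ≤ G * Δ := by
      gcongr; exact A.grad_g t ht n _ hx
    have h7 : Δ ≤ p.α * (d * F / p.δ + dualMax I p u T * J) := by
      refine (norm_xhat_succ_sub_le A B hu ht hJ (hJg t ht)).trans ?_
      gcongr
      exact dual_le_dualMax I p u (by rw [Finset.mem_Icc] at ht ⊢; omega)
    have h8 : Δ ^ 2 ≤ 2 * (p.α ^ 2 * (d : ℝ) ^ 2 * F ^ 2 / p.δ ^ 2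
        + p.α ^ 2 * J ^ 2 * dualMax I p u T ^ 2) := by
      calc Δ ^ 2 ≤ (p.α * (d * F / p.δ + dualMax I p u T * J)) ^ 2 := by gcongr
        _ ≤ 2 * ((p.α * (d * F / p.δ)) ^ 2 + (p.α * (dualMax I p u T * J)) ^ 2) := by
          rw [mul_add]; exact add_sq_le
        _ = _ := by ring
    -- Young's inequality, the source of β; the factor 2 in `h8` cancels its β/2.
    have h9 : G * Δ ≤ G ^ 2 / (2 * β) + β / 2 * Δ ^ 2 := by
      have : 0 ≤ (G - β * Δ) ^ 2 / (2 * β) := by positivity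
      have e : G ^ 2 / (2 * β) + β / 2 * Δ ^ 2 - G * Δ = (G - β * Δ) ^ 2 / (2 * β) := by
        field_simp; ring
      linarith
    have h10 : β / 2 * Δ ^ 2 ≤ β / 2 * (2 * (p.α ^ 2 * (d : ℝ) ^ 2 * F ^ 2 / p.δ ^ 2
        + p.α ^ 2 * J ^ 2 * dualMax I p u T ^ 2)) := by gcongr
    rw [hq]
    linarith
  have hsum : ∀ n, ∑ t ∈ Finset.Icc 1 T, I.g t (action I p u t) n ≤
      dual I p u (T + 1) n / p.μ + T * q := by
    intro n
    refine (Finset.sum_le_sum fun t ht => hslot t ht n).trans_eq ?_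
    rw [Finset.sum_add_distrib, Finset.sum_const, Nat.card_Icc, Nat.add_sub_cancel, nsmul_eq_mul,
      ← Finset.sum_div, sum_Icc_one, Finset.sum_range_sub (fun t => dual I p u (t + 1) n) T,
      dual_one]
    simp
  have hfit : dynFit I p u T ≤ ‖(p.μ)⁻¹ • dual I p u (T + 1)‖ + √N * (T * q) := by
    refine norm_le_add_sqrt_mul hc (fun n => le_max_right _ _) fun n => ?_
    have hd := dual_nonneg I p u (T + 1) n
    refine max_le ?_ ?_
    · simpa [div_eq_inv_mul] using hsum n
    · simp only [PiLp.smul_apply, smul_eq_mul]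
      positivity
  rw [norm_smul, norm_inv, Real.norm_eq_abs, abs_of_pos hμ] at hfit
  have h1 : (p.μ)⁻¹ * ‖dual I p u (T + 1)‖ ≤ (p.μ)⁻¹ * dualMax I p u T := by
    gcongr
    exact dual_le_dualMax I p u (by simp)
  refine (hfit.trans (add_le_add_left h1 _)).trans_eq ?_
  rw [hq]
  ring

/-- Each coordinate of λ grows by at most 2μRG per slot. This crude bound gives integrability, and
later caps ‖λ‖ on the exceptional event. -/
theorem dualMax_le (A : Assumptions I T F G r R η p.γ) (B : Admissible I p r) (u : ℕ → Vec d) :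
    dualMax I p u T ≤ T * (p.μ * (√N * (2 * R * G))) := by
  have hμ := B.mu_pos
  have hR := A.R_pos
  have hind : ∀ t ≤ T, ‖dual I p u (t + 1)‖ ≤ t * (p.μ * (√N * (2 * R * G))) := by
    intro t
    induction t with
    | zero => simp [dual_one]
    | succ k ih =>
      intro hk
      have ht : k + 1 ∈ Finset.Icc 1 T := Finset.mem_Icc.2 ⟨by omega, hk⟩
      have hG := A.G_nonneg ht
      have h1 : ‖dual I p u (k + 1 + 1)‖ ≤
          ‖dual I p u (k + 1)‖ + √N * (p.μ * (2 * R * G)) := by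
        refine norm_le_add_sqrt_mul (by positivity) (dual_nonneg I p u _) fun n => ?_
        have h2 := linearized_constraint_le A B u ht n
        have h3 : 2 * R * ‖I.gradG (k + 1) n (xhat I p u (k + 1))‖ ≤ 2 * R * G := by
          gcongr; exact A.grad_g _ ht n _ (xhat_mem_X A B u _)
        have h4 := dual_nonneg I p u (k + 1) n
        rw [dual_succ I p u (by omega)]
        refine max_le ?_ (by positivity)
        gcongr
        linarith [A.eta_pos]
      push_cast
      linarith [ih (by omega)]
  refine Finset.sup'_le _ _ fun t ht => ?_
  rw [Finset.mem_Icc] at ht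
  obtain ⟨k, rfl⟩ := Nat.exists_eq_add_of_le' ht.1
  have hk : k ≤ T := by omega
  refine (hind k hk).trans ?_
  rcases Nat.eq_zero_or_pos T with h | h
  · subst h
    simp [Nat.le_zero.1 hk]
  · have hG := A.G_nonneg (t := 1) (Finset.mem_Icc.2 ⟨le_rfl, h⟩)
    gcongr

end

/-! ### Measurability, independence, and the expected regret. -/

section

variable {d N : ℕ} {I : Problem d N} {p : Params d} {T : ℕ} {F G r R η : ℝ}

theorem measurable_gradG (I : Problem d N) (t : ℕ) (n : Fin N) : Measurable (I.gradG t n) :=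
  (InnerProductSpace.toDual ℝ (Vec d)).symm.continuous.measurable.comp
    (measurable_fderiv ℝ fun y => I.g t y n)

theorem measurable_onePoint {f : Vec d → ℝ} (hf : Continuous f) (δ : ℝ) {β : Type*}
    [MeasurableSpace β] {x u : β → Vec d} (hx : Measurable x) (hu : Measurable u) :
    Measurable fun b => onePoint δ f (x b) (u b) := by
  have := hf.measurable
  unfold onePoint
  fun_prop

/-- The parameter space is arbitrary because the lemma serves both the sample space and, in
`indepFun_state`, a finite product of spheres. The slots stop at T + 1 because continuity of the
data is known only up to slot T. -/
theorem measurable_state (A : Assumptions I T F G r R η p.γ) (hγ : p.γ < 1) {β : Type*}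
    [MeasurableSpace β] {w : β → ℕ → Vec d} (hw : ∀ i, Measurable fun b => w b i) {t : ℕ}
    (ht : t ≤ T + 1) :
    Measurable (fun b => xhat I p (w b) t) ∧ Measurable (fun b => dual I p (w b) t) := by
  induction t with
  | zero => exact ⟨measurable_const, measurable_const⟩
  | succ k ih =>
    rcases Nat.eq_zero_or_pos k with rfl | hk
    · exact ⟨measurable_const, measurable_const⟩
    · have hk' : k ∈ Finset.Icc 1 T := Finset.mem_Icc.2 ⟨hk, by omega⟩
      obtain ⟨hx, hl⟩ := ih (by omega)
      have hln : ∀ n, Measurable fun b => dual I p (w b) k n := fun n =>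
        (measurable_pi_apply n).comp ((WithLp.measurable_ofLp 2 _).comp hl)
      have hx' : Measurable fun b => xhat I p (w b) (k + 1) := by
        simp only [xhat_succ I p _ hk, primalStep, lagrangianGrad]
        have hsum : Measurable fun b =>
            ∑ n, dual I p (w b) k n • I.gradG k n (xhat I p (w b) k) :=
          Finset.measurable_sum _ fun n _ => (hln n).smul ((measurable_gradG I k n).comp hx)
        exact (continuous_proj (A.closed_shrunk hγ) A.nonempty_shrunk
          A.convex_shrunk).measurable.comp (hx.sub (((measurable_onePoint (A.continuous_f hk') p.δ
            hx (hw k)).add hsum).const_smul p.α))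
      refine ⟨hx', ?_⟩
      simp only [dual_succ I p _ hk, dualStep]
      refine (WithLp.measurable_toLp 2 _).comp (measurable_pi_lambda _ fun n => ?_)
      have hg : Measurable fun b => I.g k (xhat I p (w b) k) n :=
        (A.continuous_g hk' n).measurable.comp hx
      have hG : Measurable fun b => I.gradG k n (xhat I p (w b) k) :=
        (measurable_gradG I k n).comp hx
      exact ((hln n).add ((hg.add (hG.inner (hx'.sub hx))).const_mul _)).max measurable_const

theorem state_congr (I : Problem d N) (p : Params d) {u v : ℕ → Vec d} {t : ℕ}
    (h : ∀ i < t, u i = v i) : state I p u t = state I p v t := by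
  induction t with
  | zero => rfl
  | succ k ih =>
    match k with
    | 0 => rfl
    | m + 1 =>
      have e := ih fun i hi => h i (by omega)
      simp only [state, e, h (m + 1) (by omega)]

variable {Ω : Type*} [MeasurableSpace Ω] {P : Measure Ω} {u : ℕ → Ω → sphere (0 : Vec d) 1}

theorem UniformDirections.measurable_directions (hu : UniformDirections P u) (i : ℕ) :
    Measurable fun ω => directions u ω i := measurable_subtype_coe.comp (hu.measurable i)

theorem measurable_xhat_dual (A : Assumptions I T F G r R η p.γ) (hγ : p.γ < 1)
    (hu : UniformDirections P u) {t : ℕ} (ht : t ≤ T + 1) :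
    Measurable (fun ω => (xhat I p (directions u ω) t, dual I p (directions u ω) t)) :=
  (measurable_state A hγ hu.measurable_directions ht).1.prodMk
    (measurable_state A hγ hu.measurable_directions ht).2

/-- The iterates of slot t are a measurable function of the directions of index below t; by
`state_congr`, filling the other directions with 0 changes nothing. -/
theorem indepFun_state (A : Assumptions I T F G r R η p.γ) (hγ : p.γ < 1)
    (hu : UniformDirections P u) {t : ℕ} (ht : t ≤ T + 1) :
    IndepFun (fun ω => (xhat I p (directions u ω) t, dual I p (directions u ω) t)) (u t) P := by
  have hind := hu.indep.indepFun_finset (Finset.range t) {t} (by simp) hu.measurable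
  let w : (Finset.range t → sphere (0 : Vec d) 1) → ℕ → Vec d := fun v i =>
    if h : i ∈ Finset.range t then v ⟨i, h⟩ else 0
  have hw : ∀ i, Measurable fun v => w v i := by
    intro i
    by_cases h : i ∈ Finset.range t
    · simp only [w, h, dif_pos]
      exact measurable_subtype_coe.comp (measurable_pi_apply _)
    · simp only [w, h, dif_neg, not_false_iff]
      exact measurable_const
  have hm := measurable_state A hγ hw ht
  have h := hind.comp (hm.1.prodMk hm.2) (measurable_pi_apply (⟨t, by simp⟩ : ({t} : Finset ℕ)))
  convert h using 1
  swap
  · rfl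
  funext ω
  have e : state I p (directions u ω) t =
      state I p (w fun i => u i ω) t := by
    refine state_congr I p fun i hi => ?_
    simp [w, hi, directions]
  simp only [xhat, dual, Function.comp_apply, e]

theorem measurable_action (A : Assumptions I T F G r R η p.γ) (hγ : p.γ < 1)
    (hu : UniformDirections P u) {t : ℕ} (ht : t ≤ T + 1) :
    Measurable fun ω => action I p (directions u ω) t :=
  (measurable_state A hγ hu.measurable_directions ht).1.add
    ((hu.measurable_directions t).const_smul p.δ)

theorem measurable_dualMax (A : Assumptions I T F G r R η p.γ) (hγ : p.γ < 1)
    (hu : UniformDirections P u) : Measurable fun ω => dualMax I p (directions u ω) T := by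
  have hne : (Finset.Icc 1 (T + 1)).Nonempty := ⟨1, by simp⟩
  have h := Finset.measurable_sup' hne
    (f := fun t ω => ‖dual I p (directions u ω) t‖) fun t ht =>
      (measurable_state A hγ hu.measurable_directions (Finset.mem_Icc.1 ht).2).2.norm
  convert h using 1
  funext ω
  exact (Finset.sup'_apply (C := fun _ => ℝ) hne
    (fun t ω => ‖dual I p (directions u ω) t‖) ω).symm

variable [IsProbabilityMeasure P]

/-- Expectation over the direction of slot `t`, conditionally on the iterates of slot `t`. -/
theorem integral_state_eq (A : Assumptions I T F G r R η p.γ) (hγ : p.γ < 1)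
    (hu : UniformDirections P u) {t : ℕ} (ht : t ≤ T + 1)
    {H : (Vec d × EuclideanSpace ℝ (Fin N)) × sphere (0 : Vec d) 1 → ℝ} (hH : Measurable H)
    (hint : Integrable (fun ω =>
      H ((xhat I p (directions u ω) t, dual I p (directions u ω) t), u t ω)) P) :
    Integrable (fun ω => ∫ s, H ((xhat I p (directions u ω) t, dual I p (directions u ω) t), s)
      ∂sphereUniform d) P ∧
    ∫ ω, H ((xhat I p (directions u ω) t, dual I p (directions u ω) t), u t ω) ∂P =
      ∫ ω, ∫ s, H ((xhat I p (directions u ω) t, dual I p (directions u ω) t), s)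
        ∂sphereUniform d ∂P := by
  have hσ : IsProbabilityMeasure (sphereUniform d) := by
    rw [← hu.law t]
    exact Measure.isProbabilityMeasure_map (hu.measurable t).aemeasurable
  have hst := measurable_xhat_dual A hγ hu ht
  set st := fun ω => (xhat I p (directions u ω) t, dual I p (directions u ω) t) with hst_def
  -- The joint law of the iterates and the current direction is a product, so Fubini replaces
  -- conditional expectation.
  have hprod := (indepFun_iff_map_prod_eq_prod_map_map hst.aemeasurable
    (hu.measurable t).aemeasurable).1 (indepFun_state A hγ hu ht)
  rw [hu.law t] at hprod
  have hpm := hst.prodMk (hu.measurable t)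
  have hprob := Measure.isProbabilityMeasure_map (μ := P) hst.aemeasurable
  have hint' : Integrable H ((P.map st).prod (sphereUniform d)) := by
    rw [← hprod]
    exact (integrable_map_measure hH.aestronglyMeasurable hpm.aemeasurable).2 hint
  refine ⟨?_, ?_⟩
  · exact (integrable_map_measure (f := st) hint'.integral_prod_left.aestronglyMeasurable
      hst.aemeasurable).1 hint'.integral_prod_left
  · calc _ = ∫ z, H z ∂(P.map fun ω => (st ω, u t ω)) :=
        (integral_map hpm.aemeasurable hH.aestronglyMeasurable).symm
      _ = ∫ q, ∫ s, H (q, s) ∂sphereUniform d ∂(P.map st) := by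
        rw [hprod, integral_prod _ hint']
      _ = _ := integral_map hst.aemeasurable hint'.integral_prod_left.aestronglyMeasurable

theorem integrable_f_action (A : Assumptions I T F G r R η p.γ) (B : Admissible I p r)
    (hu : UniformDirections P u) {t : ℕ} (ht : t ∈ Finset.Icc 1 T) :
    Integrable (fun ω => I.f t (action I p (directions u ω) t)) P :=
  Integrable.of_bound ((A.continuous_f ht).measurable.comp (measurable_action A B.gamma_lt hu
    (by rw [Finset.mem_Icc] at ht; omega))).aestronglyMeasurable F (ae_of_all _ fun ω =>
      A.bound_f t ht _ (action_mem A B (norm_directions u ω) t))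

theorem integrable_f_xhat (A : Assumptions I T F G r R η p.γ) (B : Admissible I p r)
    (hu : UniformDirections P u) {t : ℕ} (ht : t ∈ Finset.Icc 1 T) :
    Integrable (fun ω => I.f t (xhat I p (directions u ω) t)) P :=
  Integrable.of_bound ((A.continuous_f ht).measurable.comp (measurable_state A B.gamma_lt
    hu.measurable_directions (by rw [Finset.mem_Icc] at ht; omega)).1).aestronglyMeasurable F
    (ae_of_all _ fun ω => A.bound_f t ht _ (xhat_mem_X A B _ t))

theorem integrable_dualMax (A : Assumptions I T F G r R η p.γ) (B : Admissible I p r)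
    (hu : UniformDirections P u) : Integrable (fun ω => dualMax I p (directions u ω) T) P :=
  Integrable.of_bound (measurable_dualMax A B.gamma_lt hu).aestronglyMeasurable
    (T * (p.μ * (√N * (2 * R * G)))) (ae_of_all _ fun ω => by
      rw [Real.norm_eq_abs, abs_of_nonneg (dualMax_nonneg _ _ _ _)]
      exact dualMax_le A B _)

theorem sum_norm_gradG_sq_le (A : Assumptions I T F G r R η p.γ) {t : ℕ}
    (ht : t ∈ Finset.Icc 1 T) {x : Vec d} (hx : x ∈ I.X) :
    ∑ n, ‖I.gradG t n x‖ ^ 2 ≤ (√N * |G|) ^ 2 := by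
  have hG := A.G_nonneg ht
  rw [mul_pow, Real.sq_sqrt (by positivity), sq_abs]
  calc _ ≤ ∑ _n : Fin N, G ^ 2 :=
        Finset.sum_le_sum fun n _ => pow_le_pow_left₀ (norm_nonneg _) (A.grad_g t ht n x hx) 2
    _ = _ := by simp

theorem integrable_dynFit (A : Assumptions I T F G r R η p.γ) (B : Admissible I p r)
    (hu : UniformDirections P u) : Integrable (fun ω => dynFit I p (directions u ω) T) P := by
  have hμ := B.mu_pos
  have hm : Measurable fun ω => dynFit I p (directions u ω) T := by
    unfold dynFit
    refine Measurable.norm ((WithLp.measurable_toLp 2 _).comp (measurable_pi_lambda _ fun n => ?_))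
    refine Measurable.max (Finset.measurable_sum _ fun t ht => ?_) measurable_const
    exact (A.continuous_g ht n).measurable.comp (measurable_action A B.gamma_lt hu
      (by rw [Finset.mem_Icc] at ht; omega))
  set D := T * (p.μ * (√N * (2 * R * G)))
  refine Integrable.of_bound hm.aestronglyMeasurable (D / p.μ + G ^ 2 * √N * T / (2 * 1)
    + p.δ * G * √N * T + 1 * √N * T * (p.α ^ 2 * (d : ℝ) ^ 2 * F ^ 2 / p.δ ^ 2
        + p.α ^ 2 * (√N * |G|) ^ 2 * D ^ 2)) (ae_of_all _ fun ω => ?_)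
  have h1 := dynFit_le A B (norm_directions u ω) (J := √N * |G|) (by positivity)
    (fun t ht x hx => sum_norm_gradG_sq_le A ht hx) one_pos
  have h2 : dualMax I p (directions u ω) T ≤ D := dualMax_le A B _
  have h3 := dualMax_nonneg I p (directions u ω) T
  rw [Real.norm_eq_abs, abs_of_nonneg (show 0 ≤ dynFit I p _ T from norm_nonneg _)]
  refine h1.trans ?_
  gcongr

/-- The conditional expectation of the one-point linearization. -/
theorem le_integral_inner_onePoint_xhat (hd : 1 ≤ d) (A : Assumptions I T F G r R η p.γ)
    (B : Admissible I p r) {t : ℕ} (ht : t ∈ Finset.Icc 1 T) (x : Vec d) {y : Vec d}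
    (hy : y ∈ (1 - p.γ) • I.X) :
    I.f t x - I.f t y - G * p.δ ≤
      ∫ s : sphere (0 : Vec d) 1, inner ℝ (onePoint p.δ (I.f t) x s) (x - y) ∂sphereUniform d := by
  have hG := A.G_nonneg ht
  have hδ := B.delta_pos
  -- The margin is c = Gδ: the δ-ball around a point of the shrunken set stays in X, where gradients
  -- are at most G.
  refine le_integral_inner_onePoint hd (A.convex_f t ht) hδ (by positivity) fun v hv => ?_
  have h1 := A.f_sub_le ht (A.add_smul_mem B.gamma_lt hδ B.delta_le hy hv) y
  have h2 : G * ‖y + p.δ • v - y‖ ≤ G * p.δ := by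
    rw [add_sub_cancel_left, norm_smul, Real.norm_eq_abs, abs_of_pos hδ]
    gcongr
    exact mul_le_of_le_one_right hδ.le hv
  linarith

theorem abs_inner_onePoint_le (A : Assumptions I T F G r R η p.γ) (B : Admissible I p r)
    {t : ℕ} (ht : t ∈ Finset.Icc 1 T) {x y v : Vec d} (hx : x ∈ (1 - p.γ) • I.X)
    (hy : y ∈ I.X) (hv : ‖v‖ = 1) :
    |inner ℝ (onePoint p.δ (I.f t) x v) (x - y)| ≤ d * F / p.δ * (2 * R) := by
  have hF := A.F_nonneg ht
  have hδ := B.delta_pos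
  have hxX := A.shrunk_subset (B.gamma_pos A.r_pos).le B.gamma_lt hx
  refine (abs_real_inner_le_norm _ _).trans ?_
  exact mul_le_mul (norm_onePoint_le A B ht hx hv) (A.norm_sub_le hxX hy)
    (norm_nonneg _) (by positivity)

theorem measurable_inner_onePoint {f : Vec d → ℝ} (hf : Continuous f) (δ : ℝ) (y : Vec d) :
    Measurable fun z : (Vec d × EuclideanSpace ℝ (Fin N)) × sphere (0 : Vec d) 1 =>
      (inner ℝ (onePoint δ f z.1.1 z.2) (z.1.1 - y) : ℝ) :=
  (measurable_onePoint hf δ measurable_fst.fst (measurable_subtype_coe.comp measurable_snd)).inner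
    (measurable_fst.fst.sub_const y)

theorem integrable_inner_onePoint (A : Assumptions I T F G r R η p.γ) (B : Admissible I p r)
    (hu : UniformDirections P u) {t : ℕ} (ht : t ∈ Finset.Icc 1 T) {y : Vec d} (hy : y ∈ I.X) :
    Integrable (fun ω => (inner ℝ (onePoint p.δ (I.f t) (xhat I p (directions u ω) t) (u t ω))
      (xhat I p (directions u ω) t - y) : ℝ)) P :=
  Integrable.of_bound ((measurable_inner_onePoint (A.continuous_f ht) p.δ y).comp
    ((measurable_xhat_dual A B.gamma_lt hu (t := t) (by rw [Finset.mem_Icc] at ht; omega)).prodMk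
      (hu.measurable t))).aestronglyMeasurable (d * F / p.δ * (2 * R))
    (ae_of_all _ fun ω => abs_inner_onePoint_le A B ht (xhat_mem A B _ t) hy
      (norm_directions u ω t))

/-- One Gδ is the bias of the estimator, the other the price of playing x̂ + δu instead of x̂. -/
theorem integral_f_action_le (hd : 1 ≤ d) (A : Assumptions I T F G r R η p.γ)
    (B : Admissible I p r) (hu : UniformDirections P u) {t : ℕ} (ht : t ∈ Finset.Icc 1 T)
    {y : Vec d} (hy : y ∈ (1 - p.γ) • I.X) :
    ∫ ω, I.f t (action I p (directions u ω) t) ∂P ≤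
      ∫ ω, (inner ℝ (onePoint p.δ (I.f t) (xhat I p (directions u ω) t) (u t ω))
        (xhat I p (directions u ω) t - y) : ℝ) ∂P + I.f t y + 2 * G * p.δ := by
  have hδ := B.delta_pos
  have hyX := A.shrunk_subset (B.gamma_pos A.r_pos).le B.gamma_lt hy
  have ht' : t ≤ T + 1 := by rw [Finset.mem_Icc] at ht; omega
  obtain ⟨h1, h2⟩ := integral_state_eq A B.gamma_lt hu ht'
    (measurable_inner_onePoint (A.continuous_f ht) p.δ y)
    (integrable_inner_onePoint A B hu ht hyX)
  have hx := integrable_f_xhat A B hu ht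
  have h3 : ∫ ω, I.f t (xhat I p (directions u ω) t) ∂P - (I.f t y + G * p.δ) ≤
      ∫ ω, (inner ℝ (onePoint p.δ (I.f t) (xhat I p (directions u ω) t) (u t ω))
        (xhat I p (directions u ω) t - y) : ℝ) ∂P := by
    rw [h2]
    have e : ∫ ω, (I.f t (xhat I p (directions u ω) t) - (I.f t y + G * p.δ)) ∂P =
        ∫ ω, I.f t (xhat I p (directions u ω) t) ∂P - (I.f t y + G * p.δ) := by
      rw [integral_sub hx (integrable_const _)]; simp
    rw [← e]
    refine integral_mono (hx.sub (integrable_const _)) h1 fun ω => ?_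
    have := le_integral_inner_onePoint_xhat hd A B ht (xhat I p (directions u ω) t) hy
    simp only
    linarith
  have h4 : ∫ ω, I.f t (action I p (directions u ω) t) ∂P ≤
      ∫ ω, I.f t (xhat I p (directions u ω) t) ∂P + G * p.δ := by
    have e : ∫ ω, (I.f t (xhat I p (directions u ω) t) + G * p.δ) ∂P =
        ∫ ω, I.f t (xhat I p (directions u ω) t) ∂P + G * p.δ := by
      rw [integral_add hx (integrable_const _)]; simp
    rw [← e]
    refine integral_mono (integrable_f_action A B hu ht) (hx.add (integrable_const _)) fun ω => ?_
    have h5 := A.f_sub_le ht (action_mem A B (norm_directions u ω) t)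
      (xhat I p (directions u ω) t)
    rw [action, add_sub_cancel_left, norm_smul, norm_directions, mul_one, Real.norm_eq_abs,
      abs_of_pos hδ] at h5
    simp only [action]
    linarith
  linarith

/-- The dynamic regret bound. -/
theorem dynRegret_le (hd : 1 ≤ d) (A : Assumptions I T F G r R η p.γ)
    (B : Admissible I p r) (hu : UniformDirections P u) {xs : ℕ → Vec d}
    (hxs : IsMinimizerPath I T xs) {J : ℝ} (hJ : 0 ≤ J)
    (hJg : ∀ t ∈ Finset.Icc 1 T, ∀ x ∈ I.X, ∑ n, ‖I.gradG t n x‖ ^ 2 ≤ J ^ 2) :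
    dynRegret P I p u xs T ≤ R / p.α * variation xs T
      + (R ^ 2 + ‖p.x₁ - xs 0‖ ^ 2) / (2 * p.α)
      + (d : ℝ) ^ 2 * F ^ 2 * p.α * T / p.δ ^ 2 + 2 * G * p.δ * T
      + p.γ * R * T * (G + J * ∫ ω, dualMax I p (directions u ω) T ∂P)
      + 2 * p.μ * J ^ 2 * R ^ 2 * T := by
  have hγ := B.gamma_pos A.r_pos
  have hα := B.alpha_pos
  have hδ := B.delta_pos
  have hdm := integrable_dualMax A B hu
  have hyK : ∀ t ∈ Finset.Icc 1 T, (1 - p.γ) • xs t ∈ (1 - p.γ) • I.X := fun t ht =>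
    smul_mem_smul_set (hxs.2 t ht).1.1
  have hyX : ∀ t ∈ Finset.Icc 1 T, (1 - p.γ) • xs t ∈ I.X := fun t ht =>
    A.shrunk_subset hγ.le B.gamma_lt (hyK t ht)
  let φ : ℕ → Ω → ℝ := fun t ω => inner ℝ (onePoint p.δ (I.f t) (xhat I p (directions u ω) t)
    (u t ω)) (xhat I p (directions u ω) t - (1 - p.γ) • xs t)
  have hφ : ∀ t ∈ Finset.Icc 1 T, Integrable (φ t) P := fun t ht =>
    integrable_inner_onePoint A B hu ht (hyX t ht)
  have h1 : dynRegret P I p u xs T ≤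
      ∑ t ∈ Finset.Icc 1 T, ∫ ω, φ t ω ∂P + T * (2 * G * p.δ + p.γ * R * G) := by
    rw [dynRegret, ← Finset.sum_sub_distrib]
    have hslot : ∀ t ∈ Finset.Icc 1 T,
        ∫ ω, I.f t (action I p (directions u ω) t) ∂P - I.f t (xs t) ≤
        ∫ ω, φ t ω ∂P + (2 * G * p.δ + p.γ * R * G) := by
      intro t ht
      have hG := A.G_nonneg ht
      have h2 := integral_f_action_le hd A B hu ht (hyK t ht)
      have h3 := A.f_sub_le ht (hyX t ht) (xs t)
      have h4 : G * ‖(1 - p.γ) • xs t - xs t‖ ≤ G * (p.γ * R) := by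
        rw [show (1 - p.γ) • xs t - xs t = -(p.γ • xs t) by module, norm_neg, norm_smul,
          Real.norm_eq_abs, abs_of_pos hγ]
        gcongr
        exact A.norm_le (hxs.2 t ht).1.1
      linarith
    refine (Finset.sum_le_sum hslot).trans_eq ?_
    rw [Finset.sum_add_distrib, Finset.sum_const, Nat.card_Icc, Nat.add_sub_cancel, nsmul_eq_mul]
  have h2 : ∑ t ∈ Finset.Icc 1 T, ∫ ω, φ t ω ∂P ≤
      R / p.α * variation xs T + (R ^ 2 + ‖p.x₁ - xs 0‖ ^ 2) / (2 * p.α)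
        + T * (p.α * (d * F / p.δ) ^ 2 / 2)
        + 2 * p.μ * J ^ 2 * R ^ 2 * T
        + p.γ * R * T * (J * ∫ ω, dualMax I p (directions u ω) T ∂P) := by
    rw [← integral_finsetSum _ hφ]
    set c := R / p.α * variation xs T + (R ^ 2 + ‖p.x₁ - xs 0‖ ^ 2) / (2 * p.α)
        + T * (p.α * (d * F / p.δ) ^ 2 / 2)
        + 2 * p.μ * J ^ 2 * R ^ 2 * T
    have e : ∫ ω, (c + p.γ * R * T * J * dualMax I p (directions u ω) T) ∂P =
        c + p.γ * R * T * (J * ∫ ω, dualMax I p (directions u ω) T ∂P) := by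
      rw [integral_add (integrable_const _) (hdm.const_mul _), integral_const_mul]
      simp [mul_assoc]
    rw [← e]
    refine integral_mono (integrable_finsetSum _ hφ)
      ((integrable_const _).add (hdm.const_mul _)) fun ω => ?_
    have := sum_inner_onePoint_le A B (norm_directions u ω) hxs hJ hJg
    simp only [φ]
    refine this.trans_eq ?_
    simp only [c]
    ring
  have h3 : (T : ℝ) * (p.α * (d * F / p.δ) ^ 2 / 2) ≤
      (d : ℝ) ^ 2 * F ^ 2 * p.α * T / p.δ ^ 2 := by
    have : 0 ≤ (d : ℝ) ^ 2 * F ^ 2 * p.α * T / p.δ ^ 2 := by positivity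
    calc _ = (d : ℝ) ^ 2 * F ^ 2 * p.α * T / p.δ ^ 2 / 2 := by ring
      _ ≤ _ := by linarith
  linarith

end

/-! ### Exponential moments and the tail of the dual iterates. -/

section

variable {d N : ℕ} {I : Problem d N} {p : Params d} {T : ℕ} {F G r R η : ℝ}

/-- Exponential moments of the linearized one-point feedback. -/
theorem integral_exp_inner_onePoint_le (hd : 1 ≤ d) (A : Assumptions I T F G r R η p.γ)
    (B : Admissible I p r) {t : ℕ} (ht : t ∈ Finset.Icc 1 T) {x y : Vec d}
    (hx : x ∈ (1 - p.γ) • I.X) (hy : y ∈ (1 - p.γ) • I.X) {a : ℝ} (ha : 0 ≤ a) :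
    ∫ s : sphere (0 : Vec d) 1, Real.exp (a * -inner ℝ (onePoint p.δ (I.f t) x s) (x - y))
      ∂sphereUniform d ≤
      Real.exp (a * (2 * F + G * p.δ) + a ^ 2 * (d * F / p.δ * (2 * R)) ^ 2 / 2) := by
  have := isProbabilityMeasure_sphereUniform hd
  have hsub := A.shrunk_subset (B.gamma_pos A.r_pos).le B.gamma_lt
  set w := d * F / p.δ * (2 * R)
  let X : sphere (0 : Vec d) 1 → ℝ := fun s => -inner ℝ (onePoint p.δ (I.f t) x s) (x - y)
  have hXb : ∀ s, |X s| ≤ w := fun s => by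
    rw [abs_neg]
    exact abs_inner_onePoint_le A B ht hx (hsub hy) (by simp)
  have hXm : Measurable X :=
    ((measurable_onePoint (A.continuous_f ht) p.δ measurable_const
      measurable_subtype_coe).inner measurable_const).neg
  have hw : 0 ≤ w := (abs_nonneg _).trans (hXb ⟨EuclideanSpace.single ⟨0, hd⟩ 1, by simp⟩)
  -- Hoeffding's lemma: values in [-w, w] give variance proxy w².
  have hsg := hasSubgaussianMGF_of_mem_Icc (μ := sphereUniform d) (a := -w) (b := w)
    hXm.aemeasurable (ae_of_all _ fun s => abs_le.1 (hXb s))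
  have hmgf := hsg.mgf_le a
  have hc : (((‖w - -w‖₊ / 2) ^ 2 : NNReal) : ℝ) = w ^ 2 := by
    push_cast
    rw [Real.norm_eq_abs, abs_of_nonneg (by linarith)]
    ring
  rw [hc, mgf] at hmgf
  set m := ∫ s, X s ∂sphereUniform d with hm
  -- The range w is of order 1/δ, yet the mean is bounded above, because the estimator is an
  -- approximate subgradient of a bounded loss.
  have hmle : m ≤ 2 * F + G * p.δ := by
    have h1 := le_integral_inner_onePoint_xhat hd A B ht x hy
    have h2 := abs_le.1 (A.bound_f t ht x (hsub hx))
    have h3 := abs_le.1 (A.bound_f t ht y (hsub hy))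
    rw [hm, integral_neg]
    linarith
  calc ∫ s, Real.exp (a * X s) ∂sphereUniform d
      = Real.exp (a * m) * ∫ s, Real.exp (a * (X s - m)) ∂sphereUniform d := by
        rw [← integral_const_mul]
        congr! 2 with s
        rw [← Real.exp_add]
        ring_nf
    _ ≤ Real.exp (a * (2 * F + G * p.δ)) * Real.exp (w ^ 2 * a ^ 2 / 2) := by
        gcongr
    _ = _ := by rw [← Real.exp_add]; ring_nf

variable {Ω : Type*} [MeasurableSpace Ω] {P : Measure Ω} [IsProbabilityMeasure P]
  {u : ℕ → Ω → sphere (0 : Vec d) 1}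

/-- The Lyapunov function of the drift analysis, for a Slater point `s`. -/
def lyapunov (I : Problem d N) (p : Params d) (s : Vec d) (u : ℕ → Vec d) (t : ℕ) : ℝ :=
  ‖dual I p u t‖ ^ 2 + ‖xhat I p u t - s‖ ^ 2

theorem integrable_exp_lyapunov (A : Assumptions I T F G r R η p.γ) (B : Admissible I p r)
    (hu : UniformDirections P u) {s : Vec d} (hs : s ∈ I.X) {θ : ℝ} (hθ : 0 ≤ θ) {t : ℕ}
    (ht : t ∈ Finset.Icc 1 (T + 1)) :
    Integrable (fun ω => Real.exp (θ * lyapunov I p s (directions u ω) t)) P := by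
  have hst := measurable_state A B.gamma_lt hu.measurable_directions (Finset.mem_Icc.1 ht).2
  refine Integrable.of_bound (Measurable.exp (((hst.2.norm.pow_const 2).add
    ((hst.1.sub_const s).norm.pow_const 2)).const_mul θ)).aestronglyMeasurable
    (Real.exp (θ * ((T * (p.μ * (√N * (2 * R * G)))) ^ 2 + (2 * R) ^ 2)))
    (ae_of_all _ fun ω => ?_)
  rw [Real.norm_eq_abs, Real.abs_exp, lyapunov]
  have h1 := (dual_le_dualMax I p (directions u ω) ht).trans (dualMax_le A B _)
  have h2 := A.norm_sub_le (xhat_mem_X A B (directions u ω) t) hs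
  gcongr

theorem lyapunov_succ_le (A : Assumptions I T F G r R η p.γ) (B : Admissible I p r)
    (hμα : p.μ = p.α) {u : ℕ → Vec d} (hu : ∀ t, ‖u t‖ = 1) {t : ℕ} (ht : t ∈ Finset.Icc 1 T)
    {s : Vec d} (hs : s ∈ (1 - p.γ) • I.X) (hgs : ∀ n, I.g t s n ≤ -η) :
    lyapunov I p s u (t + 1) ≤ lyapunov I p s u t + 2 * p.α * (-η * ‖dual I p u t‖
      + (p.α * (d * F / p.δ) ^ 2 / 2 + p.α / 2 * (N * (2 * R * G + η) ^ 2)))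
      + 2 * p.α * -inner ℝ (onePoint p.δ (I.f t) (xhat I p u t) (u t)) (xhat I p u t - s) := by
  have hα := B.alpha_pos
  have h := slot_drift_le A B hu ht hs hgs
  rw [hμα, ← add_div, div_le_iff₀ (by positivity)] at h
  simp only [lyapunov]
  linarith

/-- Given the iterates, the drift is at most 2α(c - η‖λ‖) after averaging the exponential. If η‖λ‖ ≥
c it does not increase; otherwise Φ is at most (c/η)² + 4R² and rises by at most 2αc. The sum of the
two exponentials covers both cases. -/
theorem integral_exp_lyapunov_succ_le (hd : 1 ≤ d) (A : Assumptions I T F G r R η p.γ)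
    (B : Admissible I p r) (hμα : p.μ = p.α) (hu : UniformDirections P u) {t : ℕ}
    (ht : t ∈ Finset.Icc 1 T) {s : Vec d} (hs : s ∈ (1 - p.γ) • I.X)
    (hgs : ∀ n, I.g t s n ≤ -η) {θ c : ℝ} (hθ : 0 ≤ θ)
    (hθw : p.α * θ * (d * F / p.δ * (2 * R)) ^ 2 ≤ 1)
    (hc : p.α * (d * F / p.δ) ^ 2 / 2 + p.α / 2 * (N * (2 * R * G + η) ^ 2)
      + (2 * F + G * p.δ) + 1 ≤ c) :
    ∫ ω, Real.exp (θ * lyapunov I p s (directions u ω) (t + 1)) ∂P ≤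
      ∫ ω, Real.exp (θ * lyapunov I p s (directions u ω) t) ∂P
        + Real.exp (θ * ((c / η) ^ 2 + 4 * R ^ 2 + 2 * p.α * c)) := by
  have hα := B.alpha_pos
  have hη := A.eta_pos
  have hF := A.F_nonneg ht
  have hG := A.G_nonneg ht
  have hR := A.R_pos
  have hδ := B.delta_pos
  have hsX := A.shrunk_subset (B.gamma_pos A.r_pos).le B.gamma_lt hs
  have ht1 : t ≤ T + 1 := by rw [Finset.mem_Icc] at ht; omega
  have htI : t ∈ Finset.Icc 1 (T + 1) := by rw [Finset.mem_Icc] at ht ⊢; omega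
  have htI' : t + 1 ∈ Finset.Icc 1 (T + 1) := by rw [Finset.mem_Icc] at ht ⊢; omega
  set w := d * F / p.δ * (2 * R) with hw
  set c₁ := p.α * (d * F / p.δ) ^ 2 / 2 + p.α / 2 * (N * (2 * R * G + η) ^ 2) with hc₁
  have hc₁0 : 0 ≤ c₁ := by positivity
  have hc0 : 0 ≤ c := by
    have : 0 ≤ G * p.δ := by positivity
    linarith
  let h : Vec d × EuclideanSpace ℝ (Fin N) → ℝ := fun q =>
    θ * (‖q.2‖ ^ 2 + ‖q.1 - s‖ ^ 2) + θ * (2 * p.α * (-η * ‖q.2‖ + c₁))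
  let H : (Vec d × EuclideanSpace ℝ (Fin N)) × sphere (0 : Vec d) 1 → ℝ := fun z =>
    Real.exp (h z.1) *
      Real.exp (2 * p.α * θ * -inner ℝ (onePoint p.δ (I.f t) z.1.1 z.2) (z.1.1 - s))
  have hhm : Measurable h := by fun_prop
  have hHm : Measurable H := (hhm.comp measurable_fst).exp.mul
    (((measurable_inner_onePoint (A.continuous_f ht) p.δ s).neg.const_mul (2 * p.α * θ)).exp)
  let st : Ω → Vec d × EuclideanSpace ℝ (Fin N) := fun ω =>
    (xhat I p (directions u ω) t, dual I p (directions u ω) t)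
  have hst : Measurable st := measurable_xhat_dual A B.gamma_lt hu ht1
  have hint : Integrable (fun ω => H (st ω, u t ω)) P := by
    refine Integrable.of_bound
      (hHm.comp (hst.prodMk (hu.measurable t))).aestronglyMeasurable
      (Real.exp (θ * ((T * (p.μ * (√N * (2 * R * G)))) ^ 2 + (2 * R) ^ 2)
        + θ * (2 * p.α * c₁)) * Real.exp (2 * p.α * θ * w)) (ae_of_all _ fun ω => ?_)
    have h1 := (dual_le_dualMax I p (directions u ω) htI).trans (dualMax_le A B _)
    have h2 := A.norm_sub_le (xhat_mem_X A B (directions u ω) t) hsX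
    have h3 := abs_inner_onePoint_le A B ht (xhat_mem A B (directions u ω) t) hsX
      (norm_directions u ω t)
    have h4 : -inner ℝ (onePoint p.δ (I.f t) (xhat I p (directions u ω) t) (u t ω))
      (xhat I p (directions u ω) t - s) ≤ w := by
      have := neg_le_of_abs_le h3
      simp only [directions] at this ⊢
      linarith
    have h5 : -η * ‖dual I p (directions u ω) t‖ + c₁ ≤ c₁ := by
      have : 0 ≤ η * ‖dual I p (directions u ω) t‖ := by positivity
      linarith
    simp only [H, h, st]
    rw [norm_mul, Real.norm_eq_abs, Real.norm_eq_abs, Real.abs_exp, Real.abs_exp]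
    gcongr
  obtain ⟨hi1, hi2⟩ := integral_state_eq A B.gamma_lt hu ht1 hHm hint
  have hstep : ∫ ω, Real.exp (θ * lyapunov I p s (directions u ω) (t + 1)) ∂P ≤
      ∫ ω, H (st ω, u t ω) ∂P := by
    refine integral_mono (integrable_exp_lyapunov A B hu hsX hθ htI') hint fun ω => ?_
    have h1 := mul_le_mul_of_nonneg_left
      (lyapunov_succ_le A B hμα (norm_directions u ω) ht hs hgs) hθ
    simp only [H, h, st]
    rw [← Real.exp_add, Real.exp_le_exp]
    refine h1.trans_eq ?_
    simp only [lyapunov, directions, hc₁]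
    ring
  refine hstep.trans (hi2.trans_le ?_)
  have e : ∫ ω, (Real.exp (θ * lyapunov I p s (directions u ω) t)
      + Real.exp (θ * ((c / η) ^ 2 + 4 * R ^ 2 + 2 * p.α * c))) ∂P =
      ∫ ω, Real.exp (θ * lyapunov I p s (directions u ω) t) ∂P
        + Real.exp (θ * ((c / η) ^ 2 + 4 * R ^ 2 + 2 * p.α * c)) := by
    rw [integral_add (integrable_exp_lyapunov A B hu hsX hθ htI) (integrable_const _)]
    simp
  rw [← e]
  refine integral_mono hi1
    ((integrable_exp_lyapunov A B hu hsX hθ htI).add (integrable_const _)) fun ω => ?_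
  have h1 := integral_exp_inner_onePoint_le hd A B ht (xhat_mem A B (directions u ω) t) hs
    (a := 2 * p.α * θ) (by positivity)
  -- The limit on θ makes the Hoeffding term linear in αθ; this is the summand 1 in `hc`.
  have h2 : (2 * p.α * θ) ^ 2 * w ^ 2 / 2 ≤ 2 * p.α * θ * 1 := by
    calc (2 * p.α * θ) ^ 2 * w ^ 2 / 2 = 2 * p.α * θ * (p.α * θ * w ^ 2) := by ring
      _ ≤ _ := by gcongr
  set l := ‖dual I p (directions u ω) t‖ with hl
  set Φ := lyapunov I p s (directions u ω) t with hΦ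
  have hinner : ∫ s', H (st ω, s') ∂sphereUniform d ≤
      Real.exp (θ * Φ + θ * (2 * p.α * (-η * l + c))) := by
    simp only [H]
    rw [integral_const_mul]
    refine (mul_le_mul_of_nonneg_left h1 (Real.exp_pos _).le).trans ?_
    rw [← Real.exp_add, Real.exp_le_exp]
    have h3 : θ * (2 * p.α * (c₁ + (2 * F + G * p.δ) + 1)) ≤ θ * (2 * p.α * c) := by gcongr
    simp only [h, st, ← hl]
    rw [hΦ, lyapunov]
    linarith
  refine hinner.trans ?_
  rcases le_total c (η * l) with hcl | hcl
  · have h4 : θ * (2 * p.α * (-η * l + c)) ≤ 0 := by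
      have : 0 ≤ θ * (2 * p.α * (η * l - c)) := by
        have : 0 ≤ η * l - c := by linarith
        positivity
      linarith
    have h5 : Real.exp (θ * Φ + θ * (2 * p.α * (-η * l + c))) ≤ Real.exp (θ * Φ) := by
      rw [Real.exp_le_exp]; linarith
    have h6 := Real.exp_pos (θ * ((c / η) ^ 2 + 4 * R ^ 2 + 2 * p.α * c))
    exact h5.trans (by linarith)
  · have hl0 : 0 ≤ l := norm_nonneg _
    have h4 : l ≤ c / η := by rw [le_div_iff₀ hη]; linarith
    have h5 : Φ ≤ (c / η) ^ 2 + 4 * R ^ 2 := by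
      have h6 := A.norm_sub_le (xhat_mem_X A B (directions u ω) t) hsX
      calc Φ = l ^ 2 + ‖xhat I p (directions u ω) t - s‖ ^ 2 := rfl
        _ ≤ (c / η) ^ 2 + (2 * R) ^ 2 := by gcongr
        _ = _ := by ring
    have h7 : -η * l + c ≤ c := by
      have : 0 ≤ η * l := by positivity
      linarith
    have h8 : Real.exp (θ * Φ + θ * (2 * p.α * (-η * l + c))) ≤
        Real.exp (θ * ((c / η) ^ 2 + 4 * R ^ 2 + 2 * p.α * c)) := by
      rw [Real.exp_le_exp, mul_add θ (_ + _)]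
      gcongr
    have h9 := Real.exp_pos (θ * Φ)
    exact h8.trans (by linarith)

/-- A high-probability bound on the dual iterates. -/
theorem measureReal_dualMax_gt_le (hd : 1 ≤ d) (A : Assumptions I T F G r R η p.γ)
    (B : Admissible I p r) (hμα : p.μ = p.α) (hu : UniformDirections P u) {θ c b : ℝ} (hθ : 0 ≤ θ)
    (hθw : p.α * θ * (d * F / p.δ * (2 * R)) ^ 2 ≤ 1) (hc0 : 0 ≤ c)
    (hc : p.α * (d * F / p.δ) ^ 2 / 2 + p.α / 2 * (N * (2 * R * G + η) ^ 2)
      + (2 * F + G * p.δ) + 1 ≤ c)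
    (hb : (c / η) ^ 2 + 4 * R ^ 2 + 2 * p.α * c ≤ b) :
    P.real {ω | √(b + 1) < dualMax I p (directions u ω) T} ≤
      ((T : ℝ) + 1) ^ 2 * Real.exp (-θ) := by
  have hα := B.alpha_pos
  obtain ⟨s, hs, hgs⟩ := A.slater
  have hsX := A.shrunk_subset (B.gamma_pos A.r_pos).le B.gamma_lt hs
  let Φ : ℕ → Ω → ℝ := fun t ω => lyapunov I p s (directions u ω) t
  have hM : ∀ t ≤ T, ∫ ω, Real.exp (θ * Φ (t + 1) ω) ∂P ≤ (t + 1) * Real.exp (θ * b) := by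
    intro t
    induction t with
    | zero =>
      intro _
      have h1 : ∀ ω, Real.exp (θ * Φ 1 ω) ≤ Real.exp (θ * b) := by
        intro ω
        have h2 := A.norm_sub_le (xhat_mem_X A B (directions u ω) 1) hsX
        have h3 : Φ 1 ω ≤ b := by
          simp only [Φ, lyapunov, dual_one, norm_zero]
          have h4 : ‖xhat I p (directions u ω) 1 - s‖ ^ 2 ≤ (2 * R) ^ 2 := by gcongr
          have h5 : 0 ≤ (c / η) ^ 2 + 2 * p.α * c := by positivity
          linarith
        gcongr
      refine (integral_mono (integrable_exp_lyapunov A B hu hsX hθ (by simp))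
        (integrable_const _) h1).trans_eq (by simp)
    | succ k ih =>
      intro hk
      have ht : k + 1 ∈ Finset.Icc 1 T := Finset.mem_Icc.2 ⟨by omega, hk⟩
      have h1 := integral_exp_lyapunov_succ_le hd A B hμα hu ht hs (hgs _ ht) hθ hθw hc
      have h2 : Real.exp (θ * ((c / η) ^ 2 + 4 * R ^ 2 + 2 * p.α * c)) ≤ Real.exp (θ * b) := by
        gcongr
      have h3 := ih (by omega)
      push_cast
      simp only [Φ] at h3 ⊢
      linarith
  -- Markov at level b + 1, one unit above the level b of the moment bound, leaves exp(-θ). The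
  -- union over T + 1 slots supplies the second factor T + 1.
  have hmarkov : ∀ t ∈ Finset.range (T + 1), P.real {ω | Real.exp (θ * (b + 1)) ≤
      Real.exp (θ * Φ (t + 1) ω)} ≤ (T + 1) * Real.exp (-θ) := by
    intro t ht
    rw [Finset.mem_range] at ht
    have h1 := mul_meas_ge_le_integral_of_nonneg (μ := P)
      (f := fun ω => Real.exp (θ * Φ (t + 1) ω)) (ae_of_all _ fun ω => (Real.exp_pos _).le)
      (integrable_exp_lyapunov A B hu hsX hθ (Finset.mem_Icc.2 ⟨by omega, by omega⟩))
      (Real.exp (θ * (b + 1)))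
    have h2 := h1.trans (hM t (by omega))
    have h3 : ((t : ℝ) + 1) ≤ T + 1 := by
      have : (t : ℝ) ≤ T := by exact_mod_cast (by omega : t ≤ T)
      linarith
    rw [mul_comm, ← le_div_iff₀ (Real.exp_pos _), mul_div_assoc, ← Real.exp_sub] at h2
    refine h2.trans ?_
    rw [show θ * b - θ * (b + 1) = -θ by ring]
    gcongr
  have hsub : {ω | √(b + 1) < dualMax I p (directions u ω) T} ⊆
      ⋃ t ∈ Finset.range (T + 1), {ω | Real.exp (θ * (b + 1)) ≤ Real.exp (θ * Φ (t + 1) ω)} := by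
    intro ω hω
    have hne : (Finset.Icc 1 (T + 1)).Nonempty := ⟨1, by simp⟩
    have hmax : √(b + 1) < (Finset.Icc 1 (T + 1)).sup' hne
      fun t => ‖dual I p (directions u ω) t‖ := hω
    obtain ⟨t, ht, hlt⟩ := (Finset.lt_sup'_iff hne).1 hmax
    rw [Finset.mem_Icc] at ht
    obtain ⟨k, rfl⟩ := Nat.exists_eq_add_of_le' ht.1
    simp only [mem_iUnion, Finset.mem_range, mem_ofPred_eq]
    refine ⟨k, by omega, ?_⟩
    have h1 : b + 1 ≤ ‖dual I p (directions u ω) (k + 1)‖ ^ 2 :=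
      (Real.sqrt_le_left (norm_nonneg _)).1 hlt.le
    have h2 : b + 1 ≤ Φ (k + 1) ω := h1.trans (le_add_of_nonneg_right (by positivity))
    gcongr
  calc _ ≤ P.real (⋃ t ∈ Finset.range (T + 1),
        {ω | Real.exp (θ * (b + 1)) ≤ Real.exp (θ * Φ (t + 1) ω)}) :=
      measureReal_mono hsub (measure_ne_top _ _)
    _ ≤ ∑ t ∈ Finset.range (T + 1), P.real
        {ω | Real.exp (θ * (b + 1)) ≤ Real.exp (θ * Φ (t + 1) ω)} :=
      measureReal_biUnion_finset_le _ _
    _ ≤ ∑ _t ∈ Finset.range (T + 1), (T + 1) * Real.exp (-θ) := Finset.sum_le_sum hmarkov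
    _ = _ := by simp; ring

end

/-! ### Rates, in the scale T = τ⁴ with α of order τ⁻³ and δ of order τ⁻¹. -/

section

variable {d N : ℕ} {I : Problem d N} {p : Params d} {T : ℕ} {F G r R η : ℝ}
  {Ω : Type*} [MeasurableSpace Ω] {P : Measure Ω} [IsProbabilityMeasure P]
  {u : ℕ → Ω → sphere (0 : Vec d) 1}

/-- The bound on `‖λ‖` that holds with high probability, as a function of the problem constants
and of the constants of the stepsizes. -/
def dualRadius (d N : ℕ) (F G R η a₂ b₁ b₂ : ℝ) : ℝ :=
  let c := a₂ * ((d : ℝ) * F / b₁) ^ 2 / 2 + a₂ / 2 * (N * (2 * R * G + η) ^ 2)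
    + (2 * F + G * b₂) + 1
  √((c / η) ^ 2 + 4 * R ^ 2 + 2 * a₂ * c + 1)

/-- The constant of the tail bound on `‖λ‖`. -/
def tailConst (d : ℕ) (F R a₂ b₁ : ℝ) : ℝ :=
  4 * (Nat.factorial 16 : ℝ) * (a₂ * (2 * d * F * R / b₁ + 1) ^ 2) ^ 16

theorem measureReal_dualRadius_lt_le (hd : 1 ≤ d) (A : Assumptions I T F G r R η p.γ)
    (B : Admissible I p r) (hμα : p.μ = p.α) (hu : UniformDirections P u) {a₂ b₁ b₂ τ : ℝ}
    (hτ : 1 ≤ τ) (hT : (T : ℝ) = τ ^ 4) (hF : 0 ≤ F) (hG : 0 ≤ G) (hb₁ : 0 < b₁)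
    (hα₂ : p.α ≤ a₂ / τ ^ 3) (hδ₁ : b₁ / τ ≤ p.δ) (hδ₂ : p.δ ≤ b₂ / τ) :
    P.real {ω | dualRadius d N F G R η a₂ b₁ b₂ < dualMax I p (directions u ω) T} ≤
      tailConst d F R a₂ b₁ / τ ^ 8 := by
  have hα := B.alpha_pos
  have hδ := B.delta_pos
  have hη := A.eta_pos
  have hR := A.R_pos
  have hτ0 : 0 < τ := by linarith
  have ha₂ : 0 < a₂ := by
    have : 0 < a₂ / τ ^ 3 := hα.trans_le hα₂
    rwa [lt_div_iff₀ (by positivity), zero_mul] at this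
  have hδb : p.δ ≤ b₂ := by
    rw [le_div_iff₀ hτ0] at hδ₂
    nlinarith
  have hαa : p.α ≤ a₂ := by
    rw [le_div_iff₀ (by positivity)] at hα₂
    nlinarith [one_le_pow₀ hτ (n := 3)]
  have hinv : 1 / p.δ ≤ τ / b₁ := by
    rw [div_le_div_iff₀ hδ hb₁]
    rw [div_le_iff₀ hτ0] at hδ₁
    linarith
  -- The noise range is at most κτ; the added 1 keeps κ positive when F = 0.
  set κ := 2 * d * F * R / b₁ + 1 with hκ
  have hκ0 : 0 < κ := by positivity
  -- The largest θ for which α ≤ a₂/τ³ and noise range at most κτ ensure αθ·(range)² ≤ 1.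
  set θ := τ / (a₂ * κ ^ 2) with hθ
  have hw : d * F / p.δ * (2 * R) ≤ κ * τ := by
    calc d * F / p.δ * (2 * R) = 2 * d * F * R * (1 / p.δ) := by ring
      _ ≤ 2 * d * F * R * (τ / b₁) := by gcongr
      _ = (κ - 1) * τ := by rw [hκ]; ring
      _ ≤ κ * τ := by gcongr; linarith
  have hθw : p.α * θ * (d * F / p.δ * (2 * R)) ^ 2 ≤ 1 := by
    calc p.α * θ * (d * F / p.δ * (2 * R)) ^ 2 ≤ a₂ / τ ^ 3 * θ * (κ * τ) ^ 2 := by gcongr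
      _ = 1 := by rw [hθ]; field_simp
  have hc : p.α * (d * F / p.δ) ^ 2 / 2 + p.α / 2 * (N * (2 * R * G + η) ^ 2)
      + (2 * F + G * p.δ) + 1 ≤ a₂ * ((d : ℝ) * F / b₁) ^ 2 / 2
      + a₂ / 2 * (N * (2 * R * G + η) ^ 2) + (2 * F + G * b₂) + 1 := by
    have h1 : p.α * (d * F / p.δ) ^ 2 ≤ a₂ * ((d : ℝ) * F / b₁) ^ 2 := by
      calc p.α * (d * F / p.δ) ^ 2 = p.α * ((d * F) ^ 2 * (1 / p.δ) ^ 2) := by ring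
        _ ≤ a₂ / τ ^ 3 * ((d * F) ^ 2 * (τ / b₁) ^ 2) := by gcongr
        _ = a₂ * ((d : ℝ) * F / b₁) ^ 2 / τ := by field_simp
        _ ≤ a₂ * ((d : ℝ) * F / b₁) ^ 2 := div_le_self (by positivity) hτ
    gcongr
  set c := a₂ * ((d : ℝ) * F / b₁) ^ 2 / 2
      + a₂ / 2 * (N * (2 * R * G + η) ^ 2) + (2 * F + G * b₂) + 1 with hc_def
  have hc0 : 0 ≤ c := le_trans (by positivity) hc
  have h1 := measureReal_dualMax_gt_le hd A B hμα hu (θ := θ) (c := c)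
    (b := (c / η) ^ 2 + 4 * R ^ 2 + 2 * a₂ * c) (by positivity) hθw hc0 hc (by gcongr)
  refine h1.trans ?_
  -- The power 16 turns (T+1)², at most 4τ⁸, into a tail of order τ⁸/τ¹⁶ = T⁻².
  have h2 := Real.pow_div_factorial_le_exp (x := θ) (by positivity) 16
  have h3 : (T : ℝ) + 1 ≤ 2 * τ ^ 4 := by
    rw [hT]; linarith [one_le_pow₀ hτ (n := 4)]
  rw [Real.exp_neg]
  calc ((T : ℝ) + 1) ^ 2 * (Real.exp θ)⁻¹
      ≤ (2 * τ ^ 4) ^ 2 * (θ ^ 16 / (Nat.factorial 16 : ℝ))⁻¹ := by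
        have : 0 < θ ^ 16 / (Nat.factorial 16 : ℝ) := by positivity
        gcongr
    _ = _ := by
        rw [hθ, tailConst, ← hκ]
        field_simp
        norm_num

/-- The deterministic growth rate of the dual iterates. -/
def growthConst (N : ℕ) (G R a₂ : ℝ) : ℝ := a₂ * (√N * (2 * R * G))

theorem dualMax_le_growth (A : Assumptions I T F G r R η p.γ)
    (B : Admissible I p r) (hμα : p.μ = p.α) {a₂ τ : ℝ} (hτ : 1 ≤ τ) (hT : (T : ℝ) = τ ^ 4)
    (hG : 0 ≤ G) (hα₂ : p.α ≤ a₂ / τ ^ 3) (u : ℕ → Vec d) :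
    dualMax I p u T ≤ growthConst N G R a₂ * τ := by
  have hR := A.R_pos
  have hτ0 : 0 < τ := by linarith
  calc dualMax I p u T ≤ T * (p.μ * (√N * (2 * R * G))) := dualMax_le A B u
    _ ≤ τ ^ 4 * (a₂ / τ ^ 3 * (√N * (2 * R * G))) := by rw [hT, hμα]; gcongr
    _ = growthConst N G R a₂ * τ := by rw [growthConst]; field_simp

/-- The bound on the mean of `‖λ‖`. -/
def meanConst (d N : ℕ) (F G R η a₂ b₁ b₂ : ℝ) : ℝ :=
  dualRadius d N F G R η a₂ b₁ b₂ + growthConst N G R a₂ * tailConst d F R a₂ b₁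

/-- Off the exceptional event the radius bounds ‖λ‖; on it ‖λ‖ grows at most like τ, against a
probability of order τ⁻⁸. -/
theorem integral_dualMax_le (hd : 1 ≤ d) (A : Assumptions I T F G r R η p.γ)
    (B : Admissible I p r) (hμα : p.μ = p.α) (hu : UniformDirections P u) {a₂ b₁ b₂ τ : ℝ}
    (hτ : 1 ≤ τ) (hT : (T : ℝ) = τ ^ 4) (hF : 0 ≤ F) (hG : 0 ≤ G) (hb₁ : 0 < b₁)
    (hα₂ : p.α ≤ a₂ / τ ^ 3) (hδ₁ : b₁ / τ ≤ p.δ) (hδ₂ : p.δ ≤ b₂ / τ) :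
    ∫ ω, dualMax I p (directions u ω) T ∂P ≤ meanConst d N F G R η a₂ b₁ b₂ := by
  have hR := A.R_pos
  have hτ0 : 0 < τ := by linarith
  have ha₂ : 0 < a₂ := by
    have : 0 < a₂ / τ ^ 3 := B.alpha_pos.trans_le hα₂
    rwa [lt_div_iff₀ (by positivity), zero_mul] at this
  set L := dualRadius d N F G R η a₂ b₁ b₂ with hL
  set D := growthConst N G R a₂ with hD
  have hD0 : 0 ≤ D := by rw [hD, growthConst]; positivity
  set S := {ω | L < dualMax I p (directions u ω) T} with hS
  have hSm : MeasurableSet S :=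
    measurableSet_lt measurable_const (measurable_dualMax A B.gamma_lt hu)
  have htail := measureReal_dualRadius_lt_le hd A B hμα hu hτ hT hF hG hb₁ hα₂ hδ₁ hδ₂
  have hi : Integrable (S.indicator fun _ => D * τ) P := (integrable_const _).indicator hSm
  have h1 : ∫ ω, dualMax I p (directions u ω) T ∂P ≤
      ∫ ω, (L + S.indicator (fun _ => D * τ) ω) ∂P := by
    refine integral_mono (integrable_dualMax A B hu) ((integrable_const _).add hi) fun ω => ?_
    by_cases hω : ω ∈ S
    · have h2 := dualMax_le_growth A B hμα hτ hT hG hα₂ (directions u ω)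
      have hL0 : 0 ≤ L := by rw [hL, dualRadius]; positivity
      simp only [indicator_of_mem hω]
      linarith
    · simp only [indicator_of_notMem hω, add_zero]
      exact not_lt.1 hω
  refine h1.trans ?_
  rw [integral_add (integrable_const _) hi, integral_indicator_const _ hSm, integral_const,
    probReal_univ, one_smul, smul_eq_mul, meanConst, ← hL, ← hD]
  have h3 : P.real S * (D * τ) ≤ D * tailConst d F R a₂ b₁ := by
    have ht0 : 0 ≤ tailConst d F R a₂ b₁ := by rw [tailConst]; positivity
    calc P.real S * (D * τ) ≤ tailConst d F R a₂ b₁ / τ ^ 8 * (D * τ) := by gcongr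
      _ = D * tailConst d F R a₂ b₁ / τ ^ 7 := by field_simp
      _ ≤ D * tailConst d F R a₂ b₁ := div_le_self (by positivity) (one_le_pow₀ hτ)
  linarith

/-- The part of the fit bound that does not depend on `‖λ‖`. -/
def fitConst (d N : ℕ) (F G a₂ b₁ b₂ : ℝ) : ℝ :=
  G ^ 2 * √N / 2 + b₂ * G * √N + √N * (a₂ * d * F / b₁) ^ 2

/-- The slope of the fit bound as a function of `‖λ‖`. -/
def fitSlope (N : ℕ) (G R a₁ a₂ : ℝ) : ℝ :=
  1 / a₁ + √N * a₂ ^ 2 * (√N * |G|) ^ 2 * growthConst N G R a₂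

/-- With β = τ the Young terms are O(τ³). One factor of ‖λ‖² is replaced by its growth bound, so the
result is linear in the maximal dual norm and its first moment suffices. -/
theorem dynFit_le_scale (A : Assumptions I T F G r R η p.γ)
    (B : Admissible I p r) (hμα : p.μ = p.α) {a₁ a₂ b₁ b₂ τ : ℝ}
    (hτ : 1 ≤ τ) (hT : (T : ℝ) = τ ^ 4) (hG : 0 ≤ G) (ha₁ : 0 < a₁) (hb₁ : 0 < b₁)
    (hα₁ : a₁ / τ ^ 3 ≤ p.α) (hα₂ : p.α ≤ a₂ / τ ^ 3) (hδ₁ : b₁ / τ ≤ p.δ) (hδ₂ : p.δ ≤ b₂ / τ)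
    {u : ℕ → Vec d} (hu : ∀ t, ‖u t‖ = 1) :
    dynFit I p u T ≤
      τ ^ 3 * (fitConst d N F G a₂ b₁ b₂ + fitSlope N G R a₁ a₂ * dualMax I p u T) := by
  have hR := A.R_pos
  have hα := B.alpha_pos
  have hδ := B.delta_pos
  have hτ0 : 0 < τ := by linarith
  have ha₂ : 0 < a₂ := by
    have : 0 < a₂ / τ ^ 3 := B.alpha_pos.trans_le hα₂
    rwa [lt_div_iff₀ (by positivity), zero_mul] at this
  have h0 := dualMax_nonneg I p u T
  have hgr := dualMax_le_growth A B hμα hτ hT hG hα₂ u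
  set M := dualMax I p u T
  set D := growthConst N G R a₂ with hD
  have hD0 : 0 ≤ D := by rw [hD, growthConst]; positivity
  have hinv : 1 / p.δ ≤ τ / b₁ := by
    rw [div_le_div_iff₀ hδ hb₁]
    rw [div_le_iff₀ hτ0] at hδ₁
    linarith
  have hfit := dynFit_le A B hu (J := √N * |G|) (by positivity)
    (fun t ht x hx => sum_norm_gradG_sq_le A ht hx) hτ0
  have e1 : M / p.μ ≤ τ ^ 3 * (1 / a₁ * M) := by
    rw [hμα]
    calc M / p.α ≤ M / (a₁ / τ ^ 3) := by gcongr
      _ = _ := by field_simp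
  have e2 : G ^ 2 * √N * T / (2 * τ) = τ ^ 3 * (G ^ 2 * √N / 2) := by
    rw [hT]; field_simp
  have e3 : p.δ * G * √N * T ≤ τ ^ 3 * (b₂ * G * √N) := by
    calc p.δ * G * √N * T ≤ b₂ / τ * G * √N * τ ^ 4 := by rw [hT]; gcongr
      _ = _ := by field_simp
  have e4 : τ * √N * T * (p.α ^ 2 * (d : ℝ) ^ 2 * F ^ 2 / p.δ ^ 2) ≤
      τ ^ 3 * (√N * (a₂ * d * F / b₁) ^ 2) := by
    calc τ * √N * T * (p.α ^ 2 * (d : ℝ) ^ 2 * F ^ 2 / p.δ ^ 2)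
        = τ * √N * τ ^ 4 * (p.α ^ 2 * (d : ℝ) ^ 2 * F ^ 2 * (1 / p.δ) ^ 2) := by rw [hT]; ring
      _ ≤ τ * √N * τ ^ 4 * ((a₂ / τ ^ 3) ^ 2 * (d : ℝ) ^ 2 * F ^ 2 * (τ / b₁) ^ 2) := by gcongr
      _ = τ * (√N * (a₂ * d * F / b₁) ^ 2) := by field_simp
      _ ≤ _ := by gcongr; exact le_self_pow₀ hτ (by norm_num)
  have e5 : τ * √N * T * (p.α ^ 2 * (√N * |G|) ^ 2 * M ^ 2) ≤
      τ ^ 3 * (√N * a₂ ^ 2 * (√N * |G|) ^ 2 * D * M) := by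
    calc τ * √N * T * (p.α ^ 2 * (√N * |G|) ^ 2 * M ^ 2)
        = τ * √N * τ ^ 4 * (p.α ^ 2 * (√N * |G|) ^ 2 * (M * M)) := by rw [hT]; ring
      _ ≤ τ * √N * τ ^ 4 * ((a₂ / τ ^ 3) ^ 2 * (√N * |G|) ^ 2 * (D * τ * M)) := by gcongr
      _ = √N * a₂ ^ 2 * (√N * |G|) ^ 2 * D * M := by field_simp
      _ ≤ _ := le_mul_of_one_le_left (by positivity) (one_le_pow₀ hτ)
  rw [fitConst, fitSlope, ← hD]
  linarith

/-- The constant of the regret rate. -/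
def regretConst (d N : ℕ) (F G r R η a₁ a₂ b₁ b₂ : ℝ) : ℝ :=
  R / a₁ + 5 * R ^ 2 / (2 * a₁) + (d : ℝ) ^ 2 * F ^ 2 * a₂ / b₁ ^ 2 + 2 * G * b₂
    + b₂ / r * R * (G + √N * |G| * meanConst d N F G R η a₂ b₁ b₂)
    + 2 * a₂ * (√N * |G|) ^ 2 * R ^ 2

theorem variation_nonneg (xs : ℕ → Vec d) (T : ℕ) : 0 ≤ variation xs T :=
  Finset.sum_nonneg fun _ _ => norm_nonneg _

theorem dynRegret_le_scale (hd : 1 ≤ d) (A : Assumptions I T F G r R η p.γ)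
    (B : Admissible I p r) (hμα : p.μ = p.α) (hγδ : p.γ = p.δ / r) (hu : UniformDirections P u)
    {xs : ℕ → Vec d} (hxs : IsMinimizerPath I T xs) {a₁ a₂ b₁ b₂ τ : ℝ}
    (hτ : 1 ≤ τ) (hT : (T : ℝ) = τ ^ 4) (hF : 0 ≤ F) (hG : 0 ≤ G) (ha₁ : 0 < a₁) (hb₁ : 0 < b₁)
    (hα₁ : a₁ / τ ^ 3 ≤ p.α) (hα₂ : p.α ≤ a₂ / τ ^ 3) (hδ₁ : b₁ / τ ≤ p.δ)
    (hδ₂ : p.δ ≤ b₂ / τ) :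
    dynRegret P I p u xs T ≤
      regretConst d N F G r R η a₁ a₂ b₁ b₂ * (1 + variation xs T) * τ ^ 3 := by
  have hR := A.R_pos
  have hr := A.r_pos
  have hα := B.alpha_pos
  have hδ := B.delta_pos
  have hτ0 : 0 < τ := by linarith
  have ha₂ : 0 < a₂ := by
    have : 0 < a₂ / τ ^ 3 := B.alpha_pos.trans_le hα₂
    rwa [lt_div_iff₀ (by positivity), zero_mul] at this
  have hb₂ : 0 < b₂ := by
    have : 0 < b₂ / τ := hδ.trans_le hδ₂
    rwa [lt_div_iff₀ hτ0, zero_mul] at this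
  have hinv : 1 / p.δ ≤ τ / b₁ := by
    rw [div_le_div_iff₀ hδ hb₁]
    rw [div_le_iff₀ hτ0] at hδ₁
    linarith
  have hreg := dynRegret_le hd A B hu hxs (J := √N * |G|) (by positivity)
    (fun t ht x hx => sum_norm_gradG_sq_le A ht hx)
  have hV := variation_nonneg xs T
  set V := variation xs T
  have hmean := integral_dualMax_le hd A B hμα hu hτ hT hF hG hb₁ hα₂ hδ₁ hδ₂
  have hE0 : 0 ≤ ∫ ω, dualMax I p (directions u ω) T ∂P :=
    integral_nonneg fun ω => dualMax_nonneg _ _ _ _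
  set E := ∫ ω, dualMax I p (directions u ω) T ∂P
  set E' := meanConst d N F G R η a₂ b₁ b₂ with hE'
  have hE'0 : 0 ≤ E' := hE0.trans hmean
  have hx0 := A.norm_sub_le (A.shrunk_subset (B.gamma_pos hr).le B.gamma_lt B.init_mem) hxs.1
  have hτ3 : τ ≤ τ ^ 3 := le_self_pow₀ hτ (by norm_num)
  have e1 : R / p.α * V ≤ R / a₁ * V * τ ^ 3 := by
    calc R / p.α * V ≤ R / (a₁ / τ ^ 3) * V := by gcongr
      _ = _ := by field_simp
  have e2 : (R ^ 2 + ‖p.x₁ - xs 0‖ ^ 2) / (2 * p.α) ≤ 5 * R ^ 2 / (2 * a₁) * τ ^ 3 := by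
    calc (R ^ 2 + ‖p.x₁ - xs 0‖ ^ 2) / (2 * p.α)
        ≤ (R ^ 2 + (2 * R) ^ 2) / (2 * (a₁ / τ ^ 3)) := by gcongr
      _ = _ := by field_simp; ring
  have e3 : (d : ℝ) ^ 2 * F ^ 2 * p.α * T / p.δ ^ 2 ≤
      (d : ℝ) ^ 2 * F ^ 2 * a₂ / b₁ ^ 2 * τ ^ 3 := by
    calc (d : ℝ) ^ 2 * F ^ 2 * p.α * T / p.δ ^ 2
        = (d : ℝ) ^ 2 * F ^ 2 * p.α * τ ^ 4 * (1 / p.δ) ^ 2 := by rw [hT]; ring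
      _ ≤ (d : ℝ) ^ 2 * F ^ 2 * (a₂ / τ ^ 3) * τ ^ 4 * (τ / b₁) ^ 2 := by gcongr
      _ = _ := by field_simp
  have e4 : 2 * G * p.δ * T ≤ 2 * G * b₂ * τ ^ 3 := by
    calc 2 * G * p.δ * T ≤ 2 * G * (b₂ / τ) * τ ^ 4 := by rw [hT]; gcongr
      _ = _ := by field_simp
  have e5 : p.γ * R * T * (G + √N * |G| * E) ≤ b₂ / r * R * (G + √N * |G| * E') * τ ^ 3 := by
    calc p.γ * R * T * (G + √N * |G| * E)
        ≤ b₂ / τ / r * R * τ ^ 4 * (G + √N * |G| * E') := by rw [hT, hγδ]; gcongr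
      _ = _ := by field_simp
  have e6 : 2 * p.μ * (√N * |G|) ^ 2 * R ^ 2 * T ≤
      2 * a₂ * (√N * |G|) ^ 2 * R ^ 2 * τ ^ 3 := by
    calc 2 * p.μ * (√N * |G|) ^ 2 * R ^ 2 * T
        ≤ 2 * (a₂ / τ ^ 3) * (√N * |G|) ^ 2 * R ^ 2 * τ ^ 4 := by rw [hT, hμα]; gcongr
      _ = 2 * a₂ * (√N * |G|) ^ 2 * R ^ 2 * τ := by field_simp
      _ ≤ _ := by gcongr
  -- These two nonnegative terms are the surplus in the product C(1 + V): the constants other than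
  -- R/a₁ times V, and R/a₁ times 1.
  have e7 : 0 ≤ (5 * R ^ 2 / (2 * a₁) + (d : ℝ) ^ 2 * F ^ 2 * a₂ / b₁ ^ 2 + 2 * G * b₂
    + b₂ / r * R * (G + √N * |G| * E') + 2 * a₂ * (√N * |G|) ^ 2 * R ^ 2) * V * τ ^ 3 := by
    positivity
  have e8 : 0 ≤ R / a₁ * τ ^ 3 := by positivity
  rw [regretConst, ← hE']
  linarith

/-- A constant for all rates. -/
def rateConst (d N : ℕ) (F G r R η a₁ a₂ b₁ b₂ : ℝ) : ℝ :=
  regretConst d N F G r R η a₁ a₂ b₁ b₂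
    + (fitConst d N F G a₂ b₁ b₂ + fitSlope N G R a₁ a₂ * meanConst d N F G R η a₂ b₁ b₂)
    + tailConst d F R a₂ b₁

/-- The rates, with the horizon written as `τ ^ 4`. -/
theorem rates_of_scale (hd : 1 ≤ d) (A : Assumptions I T F G r R η p.γ)
    (B : Admissible I p r) (hμα : p.μ = p.α) (hγδ : p.γ = p.δ / r) (hu : UniformDirections P u)
    {xs : ℕ → Vec d} (hxs : IsMinimizerPath I T xs) {a₁ a₂ b₁ b₂ τ : ℝ}
    (hτ : 1 ≤ τ) (hT : (T : ℝ) = τ ^ 4) (hF : 0 ≤ F) (hG : 0 ≤ G) (ha₁ : 0 < a₁) (hb₁ : 0 < b₁)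
    (hα₁ : a₁ / τ ^ 3 ≤ p.α) (hα₂ : p.α ≤ a₂ / τ ^ 3) (hδ₁ : b₁ / τ ≤ p.δ)
    (hδ₂ : p.δ ≤ b₂ / τ) :
    dynRegret P I p u xs T ≤
        rateConst d N F G r R η a₁ a₂ b₁ b₂ * (1 + variation xs T) * τ ^ 3 ∧
      ∫ ω, dynFit I p (directions u ω) T ∂P ≤ rateConst d N F G r R η a₁ a₂ b₁ b₂ * τ ^ 3 ∧
      P.real {ω | rateConst d N F G r R η a₁ a₂ b₁ b₂ * τ ^ 3 <
        dynFit I p (directions u ω) T} ≤ rateConst d N F G r R η a₁ a₂ b₁ b₂ / τ ^ 8 := by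
  have hR := A.R_pos
  have hr := A.r_pos
  have hη := A.eta_pos
  have hτ0 : 0 < τ := by linarith
  have ha₂ : 0 < a₂ := by
    have : 0 < a₂ / τ ^ 3 := B.alpha_pos.trans_le hα₂
    rwa [lt_div_iff₀ (by positivity), zero_mul] at this
  have hb₂ : 0 < b₂ := by
    have : 0 < b₂ / τ := B.delta_pos.trans_le hδ₂
    rwa [lt_div_iff₀ hτ0, zero_mul] at this
  have hV := variation_nonneg xs T
  have hD : 0 ≤ growthConst N G R a₂ := by unfold growthConst; positivity
  have htail : 0 ≤ tailConst d F R a₂ b₁ := by unfold tailConst; positivity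
  have hrad : 0 ≤ dualRadius d N F G R η a₂ b₁ b₂ := by unfold dualRadius; positivity
  have hmean : 0 ≤ meanConst d N F G R η a₂ b₁ b₂ := by unfold meanConst; positivity
  have hradmean : dualRadius d N F G R η a₂ b₁ b₂ ≤ meanConst d N F G R η a₂ b₁ b₂ :=
    le_add_of_nonneg_right (by positivity)
  have hslope : 0 ≤ fitSlope N G R a₁ a₂ := by unfold fitSlope; positivity
  have hfit : 0 ≤ fitConst d N F G a₂ b₁ b₂ := by unfold fitConst; positivity
  have hreg : 0 ≤ regretConst d N F G r R η a₁ a₂ b₁ b₂ := by unfold regretConst; positivity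
  have hfm : 0 ≤ fitSlope N G R a₁ a₂ * meanConst d N F G R η a₂ b₁ b₂ := by positivity
  have h1 := dynRegret_le_scale hd A B hμα hγδ hu hxs hτ hT hF hG ha₁ hb₁ hα₁ hα₂ hδ₁ hδ₂
  have h2 := integral_dualMax_le hd A B hμα hu hτ hT hF hG hb₁ hα₂ hδ₁ hδ₂
  have h3 := measureReal_dualRadius_lt_le hd A B hμα hu hτ hT hF hG hb₁ hα₂ hδ₁ hδ₂
  have h4 := fun ω => dynFit_le_scale A B hμα hτ hT hG ha₁ hb₁ hα₁ hα₂ hδ₁ hδ₂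
    (norm_directions u ω)
  set C := rateConst d N F G r R η a₁ a₂ b₁ b₂ with hC
  rw [rateConst] at hC
  refine ⟨h1.trans ?_, ?_, ?_⟩
  · gcongr
    linarith
  · have hdm := integrable_dualMax A B hu
    calc ∫ ω, dynFit I p (directions u ω) T ∂P
        ≤ ∫ ω, τ ^ 3 * (fitConst d N F G a₂ b₁ b₂
          + fitSlope N G R a₁ a₂ * dualMax I p (directions u ω) T) ∂P :=
          integral_mono (integrable_dynFit A B hu)
            (((integrable_const _).add (hdm.const_mul _)).const_mul _) h4
      _ = τ ^ 3 * (fitConst d N F G a₂ b₁ b₂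
          + fitSlope N G R a₁ a₂ * ∫ ω, dualMax I p (directions u ω) T ∂P) := by
          rw [integral_const_mul, integral_add (integrable_const _) (hdm.const_mul _),
            integral_const_mul]
          simp
      _ ≤ τ ^ 3 * (fitConst d N F G a₂ b₁ b₂
          + fitSlope N G R a₁ a₂ * meanConst d N F G R η a₂ b₁ b₂) := by gcongr
      _ ≤ τ ^ 3 * C := by gcongr; linarith
      _ = C * τ ^ 3 := mul_comm _ _
  -- A large fit forces a large dual norm, because the fit bound with ‖λ‖ at the radius is already
  -- below Cτ³.
  · have hsub : {ω | C * τ ^ 3 < dynFit I p (directions u ω) T} ⊆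
        {ω | dualRadius d N F G R η a₂ b₁ b₂ < dualMax I p (directions u ω) T} := by
      intro ω hω
      by_contra hle
      have hle' : dualMax I p (directions u ω) T ≤ dualRadius d N F G R η a₂ b₁ b₂ :=
        not_lt.1 hle
      have hω' : C * τ ^ 3 < dynFit I p (directions u ω) T := hω
      have h5 : τ ^ 3 * (fitConst d N F G a₂ b₁ b₂
          + fitSlope N G R a₁ a₂ * dualMax I p (directions u ω) T) ≤ τ ^ 3 * C := by
        have h6 : fitSlope N G R a₁ a₂ * dualMax I p (directions u ω) T ≤
            fitSlope N G R a₁ a₂ * meanConst d N F G R η a₂ b₁ b₂ := by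
          gcongr
          exact hle'.trans hradmean
        gcongr
        linarith
      linarith [h4 ω]
    refine (measureReal_mono hsub (measure_ne_top _ _)).trans (h3.trans ?_)
    gcongr
    linarith

end

end BanSaP

end

theorem theorem1 (d N : ℕ) (hd : 1 ≤ d) (F G r R η : ℝ) :
    -- explicit bounds, for all admissible parameters
    (∀ (Ω : Type*) (_ : MeasurableSpace Ω) (P : Measure Ω) (_ : IsProbabilityMeasure P)
        (u : ℕ → Ω → sphere (0 : BanSaP.Vec d) 1) (_ : BanSaP.UniformDirections P u)
        (T : ℕ) (I : BanSaP.Problem d N) (p : BanSaP.Params d) (xs : ℕ → BanSaP.Vec d),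
      BanSaP.Assumptions I T F G r R η p.γ → BanSaP.Admissible I p r →
      BanSaP.IsMinimizerPath I T xs →
        (∀ t ∈ Finset.Icc 1 T,
          Integrable (fun ω => I.f t (BanSaP.action I p (BanSaP.directions u ω) t)) P) ∧
        Integrable (fun ω => BanSaP.dualMax I p (BanSaP.directions u ω) T) P ∧
        Integrable (fun ω => BanSaP.dynFit I p (BanSaP.directions u ω) T) P ∧
        ∀ J : ℝ, 0 ≤ J →
          (∀ t ∈ Finset.Icc 1 T, ∀ x ∈ I.X, ∑ n, ‖I.gradG t n x‖ ^ 2 ≤ J ^ 2) →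
        BanSaP.dynRegret P I p u xs T ≤
          R / p.α * BanSaP.variation xs T
            + (R ^ 2 + ‖p.x₁ - xs 0‖ ^ 2) / (2 * p.α)
            + (d : ℝ) ^ 2 * F ^ 2 * p.α * T / p.δ ^ 2
            + 2 * G * p.δ * T
            + p.γ * R * T *
                (G + J * ∫ ω, BanSaP.dualMax I p (BanSaP.directions u ω) T ∂P)
            + 2 * p.μ * J ^ 2 * R ^ 2 * T ∧
        ∀ β : ℝ, 0 < β → ∀ ω : Ω,
          BanSaP.dynFit I p (BanSaP.directions u ω) T ≤
            BanSaP.dualMax I p (BanSaP.directions u ω) T / p.μ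
              + G ^ 2 * √N * T / (2 * β)
              + p.δ * G * √N * T
              + β * √N * T * (p.α ^ 2 * (d : ℝ) ^ 2 * F ^ 2 / p.δ ^ 2
                + p.α ^ 2 * J ^ 2 * BanSaP.dualMax I p (BanSaP.directions u ω) T ^ 2)) ∧
    -- rates, for stepsizes of order T^(-3/4) and perturbations of order T^(-1/4)
    (∀ a₁ a₂ b₁ b₂ : ℝ, 0 < a₁ → 0 < b₁ →
      ∃ C : ℝ, ∀ (Ω : Type*) (_ : MeasurableSpace Ω) (P : Measure Ω) (_ : IsProbabilityMeasure P)
        (u : ℕ → Ω → sphere (0 : BanSaP.Vec d) 1) (_ : BanSaP.UniformDirections P u)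
        (T : ℕ) (I : BanSaP.Problem d N) (p : BanSaP.Params d) (xs : ℕ → BanSaP.Vec d),
      1 ≤ T → BanSaP.Assumptions I T F G r R η p.γ → BanSaP.IsMinimizerPath I T xs →
      p.μ = p.α → a₁ * (T : ℝ) ^ (-(3 / 4) : ℝ) ≤ p.α → p.α ≤ a₂ * (T : ℝ) ^ (-(3 / 4) : ℝ) →
      b₁ * (T : ℝ) ^ (-(1 / 4) : ℝ) ≤ p.δ → p.δ ≤ b₂ * (T : ℝ) ^ (-(1 / 4) : ℝ) →
      p.γ = p.δ / r → p.γ < 1 → p.x₁ ∈ (1 - p.γ) • I.X →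
        (∀ ω : Ω, ∀ t ∈ Finset.Icc 1 T, BanSaP.action I p (BanSaP.directions u ω) t ∈ I.X) ∧
        BanSaP.dynRegret P I p u xs T ≤
          C * (1 + BanSaP.variation xs T) * (T : ℝ) ^ (3 / 4 : ℝ) ∧
        ∫ ω, BanSaP.dynFit I p (BanSaP.directions u ω) T ∂P ≤ C * (T : ℝ) ^ (3 / 4 : ℝ) ∧
        P.real {ω | C * (T : ℝ) ^ (3 / 4 : ℝ) < BanSaP.dynFit I p (BanSaP.directions u ω) T} ≤
          C * (T : ℝ) ^ (-2 : ℝ)) := by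
  refine ⟨?_, ?_⟩
  · intro Ω _ P _ u hu T I p xs A B hxs
    exact ⟨fun t ht => BanSaP.integrable_f_action A B hu ht, BanSaP.integrable_dualMax A B hu,
      BanSaP.integrable_dynFit A B hu, fun J hJ hJg =>
        ⟨BanSaP.dynRegret_le hd A B hu hxs hJ hJg, fun β hβ ω =>
          BanSaP.dynFit_le A B (BanSaP.norm_directions u ω) hJ hJg hβ⟩⟩
  · intro a₁ a₂ b₁ b₂ ha₁ hb₁
    refine ⟨BanSaP.rateConst d N F G r R η a₁ a₂ b₁ b₂, ?_⟩
    intro Ω _ P _ u hu T I p xs hT A hxs hμα hα₁ hα₂ hδ₁ hδ₂ hγδ hγ hinit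
    have hT1 : (1 : ℝ) ≤ T := by exact_mod_cast hT
    have hT0 : (0 : ℝ) ≤ T := by linarith
    -- All real powers of T become natural powers of τ = T^(1/4).
    have hpow : ∀ (n : ℕ) (x : ℝ), x = 1 / 4 * n →
        (T : ℝ) ^ x = ((T : ℝ) ^ (1 / 4 : ℝ)) ^ n := fun n x hx => by
      rw [hx, Real.rpow_mul hT0, Real.rpow_natCast]
    have hτ : 1 ≤ (T : ℝ) ^ (1 / 4 : ℝ) := Real.one_le_rpow hT1 (by norm_num)
    have hT4 := hpow 4 1 (by norm_num)
    have hT3 := hpow 3 (3 / 4) (by norm_num)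
    have hT8 := hpow 8 2 (by norm_num)
    rw [Real.rpow_one] at hT4
    rw [Real.rpow_neg hT0] at hα₁ hα₂ hδ₁ hδ₂ ⊢
    set τ := (T : ℝ) ^ (1 / 4 : ℝ) with hτ_def
    rw [hT3, ← div_eq_mul_inv] at hα₁ hα₂
    rw [← div_eq_mul_inv] at hδ₁ hδ₂
    have hα0 : 0 < p.α := lt_of_lt_of_le (by positivity) hα₁
    have B : BanSaP.Admissible I p r :=
      ⟨hα0, hμα ▸ hα0, lt_of_lt_of_le (by positivity) hδ₁, hγ,
        by rw [hγδ, div_mul_cancel₀ _ A.r_pos.ne'], hinit⟩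
    have h1T : 1 ∈ Finset.Icc 1 T := Finset.mem_Icc.2 ⟨le_rfl, hT⟩
    have h := BanSaP.rates_of_scale hd A B hμα hγδ hu hxs hτ hT4 (A.F_nonneg h1T)
      (A.G_nonneg h1T) ha₁ hb₁ hα₁ hα₂ hδ₁ hδ₂
    rw [hT3, hT8, ← div_eq_mul_inv]
    exact ⟨fun ω t _ => BanSaP.action_mem A B (BanSaP.norm_directions u ω) t, h⟩
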